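/- Let $d\ge 1$ and $\mathcal H=\mathbb C^d$. A POVM on a finite-dimensional Hilbert space is a finite family of positive semidefinite operators summing to the identity. A POVM $\mathscr A=\{A_j\}_j$ is a coarse graining of $\mathscr C=\{C_k\}_k$ if $A_j=\sum_k\Lambda_{jk}C_k$ for some real matrix $\Lambda$ with $\Lambda_{jk}\ge 0$ and $\sum_j\Lambda_{jk}=1$ for all $k$; two POVMs $\mathscr A,\mathscr B$ on $\mathcal H$ are compatible (jointly measurable) if both are coarse grainings of one common POVM on $\mathcal H$. A POVM is simple if no element is proportional to another element. A SIC is a POVM with $d^2$ elements $\frac1d|\psi_j\rangle\langle\psi_j|$, where the $\psi_j$ are unit vectors with $|\langle\psi_j|\psi_k\rangle|^2=\frac1{d+1}$ for all $j\ne k$. For a POVM $\mathscr M=\{M_j\}_j$ on $\mathcal H^{\otimes 2}$, the two-copy estimation fidelity is $$F(\mathscr M)=\max_{\{\hat\rho_j\}}\ \sum_j\int \operatorname{tr}\bigl[(|\psi\rangle\langle\psi|)^{\otimes 2}M_j\bigr]\,\operatorname{tr}\bigl[|\psi\rangle\langle\psi|\,\hat\rho_j\bigr]\,d\mu(\psi),$$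 where $\mu$ is the normalized unitarily invariant measure on pure states of $\mathcal H$ and the maximum is over all families of density operators $\hat\rho_j$ on $\mathcal H$. Put $$F_2^{\mathrm{iid}}=\frac{2\left[d^2+d+1+(d-1)\sqrt{d+1}\right]}{d(d+1)(d+2)}.$$ Let $\mathscr A=\{A_j\}_j$ and $\mathscr B=\{B_k\}_k$ be POVMs on $\mathcal H$, and let $\mathscr A\otimes\mathscr B=\{A_j\otimes B_k\}_{j,k}$. If $\mathscr A$ and $\mathscr B$ are compatible, then $F(\mathscr A\otimes\mathscr B)\le F_2^{\mathrm{iid}}$. If in addition both $\mathscr A$ and $\mathscr B$ are simple, then equality holds if and only if $\mathscr A$ and $\mathscr B$ are identical SICs up to relabeling of the outcomes. In particular, $F(\mathscr A\otimes\mathscr B)>F_2^{\mathrm{iid}}$ implies that $\mathscr A$ and $\mathscr B$ are incompatible. -/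

import Mathlib

open scoped ComplexOrder Kronecker

/-- A POVM with outcome set `ι` on the Hilbert space `ℂⁿ` (operators are `n × n` complex matrices):
a finite family of positive semidefinite operators that sum up to the identity. -/
structure POVM (ι n : Type*) [Fintype ι] [Fintype n] [DecidableEq n] where
  elem : ι → Matrix n n ℂ
  posSemidef : ∀ j, (elem j).PosSemidef
  sum_elem : ∑ j, elem j = 1

/-- The (mixed) quantum states on `ℂᵈ`: positive semidefinite operators of trace one. -/
structure DensityOperator (d : ℕ) where
  mat : Matrix (Fin d) (Fin d) ℂ
  posSemidef : mat.PosSemidef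
  trace_eq_one : mat.trace = 1

/-- The unit vectors of `ℂᵈ`. -/
abbrev PureState (d : ℕ) : Type := Metric.sphere (0 : EuclideanSpace ℂ (Fin d)) 1

/-- The rank-one operator `|ψ⟩⟨ψ|`. -/
def ketBra {d : ℕ} (ψ : EuclideanSpace ℂ (Fin d)) : Matrix (Fin d) (Fin d) ℂ :=
  Matrix.of fun a b => ψ a * star (ψ b)

/-- The normalized (unitarily invariant) surface measure on the unit sphere of `ℂᵈ`, that is, the
distribution of a Haar-random pure state. -/
noncomputable def haarPureState (d : ℕ) : MeasureTheory.Measure (PureState d) :=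
  ((MeasureTheory.volume : MeasureTheory.Measure (EuclideanSpace ℂ (Fin d))).toSphere Set.univ)⁻¹ •
    (MeasureTheory.volume : MeasureTheory.Measure (EuclideanSpace ℂ (Fin d))).toSphere

namespace POVM

variable {ι κ m n : Type*} [Fintype ι] [Fintype κ] [Fintype m] [DecidableEq m] [Fintype n]
  [DecidableEq n]

/-- `A ≼ B`: `A` is a coarse graining of `B`, that is, `A_j = ∑_k Λ_{jk} B_k` for a stochastic
matrix `Λ` (nonnegative entries, `∑_j Λ_{jk} = 1`). -/
def IsCoarseGraining (A : POVM ι n) (B : POVM κ n) : Prop :=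
  ∃ L : ι → κ → ℝ, (∀ j k, 0 ≤ L j k) ∧ (∀ k, ∑ j, L j k = 1) ∧
    ∀ j, A.elem j = ∑ k, (L j k : ℂ) • B.elem k

/-- Two POVMs are compatible (jointly measurable) if they have a common refinement. -/
def Compatible (A : POVM ι n) (B : POVM κ n) : Prop :=
  ∃ (r : ℕ) (C : POVM (Fin r) n), A.IsCoarseGraining C ∧ B.IsCoarseGraining C

/-- A POVM is simple if no element is proportional to another element (in particular, as soon as
there are two outcomes, no element is zero). -/
def IsSimple (A : POVM ι n) : Prop :=
  ∀ j k, j ≠ k → ∀ c : ℂ, A.elem j ≠ c • A.elem k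

/-- A SIC: the `d²` elements are `|ψ_j⟩⟨ψ_j| / d`, where the `ψ_j` are unit vectors with all pairwise
fidelities equal to `1 / (d + 1)`. -/
def IsSIC {d : ℕ} (A : POVM ι (Fin d)) : Prop :=
  Fintype.card ι = d ^ 2 ∧ ∃ ψ : ι → EuclideanSpace ℂ (Fin d),
    (∀ j, ‖ψ j‖ = 1) ∧
    (∀ j k, j ≠ k → ‖inner ℂ (ψ j) (ψ k)‖ ^ 2 = 1 / ((d : ℝ) + 1)) ∧
    ∀ j, A.elem j = (1 / (d : ℂ)) • ketBra (ψ j)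

/-- Two POVMs are identical up to relabeling of the outcomes. -/
def IdenticalUpToRelabeling (A : POVM ι n) (B : POVM κ n) : Prop :=
  ∃ e : ι ≃ κ, ∀ j, A.elem j = B.elem (e j)

/-- The product POVM `A ⊗ B`, with elements `A_j ⊗ B_k`. -/
def prod (A : POVM ι m) (B : POVM κ n) : POVM (ι × κ) (m × n) where
  elem p := A.elem p.1 ⊗ₖ B.elem p.2
  posSemidef p := (A.posSemidef p.1).kronecker (B.posSemidef p.2)
  sum_elem := by
    have h : ∑ p : ι × κ, A.elem p.1 ⊗ₖ B.elem p.2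
        = (∑ j, A.elem j) ⊗ₖ (∑ k, B.elem k) := by
      ext a b
      simp only [Matrix.sum_apply, Matrix.kroneckerMap_apply, Fintype.sum_prod_type,
        Finset.sum_mul_sum]
    rw [h, A.sum_elem, B.sum_elem, Matrix.one_kronecker_one]

/-- The average fidelity of the following estimation strategy: two copies of a Haar-random pure
state `ρ = |ψ⟩⟨ψ|` on `ℂᵈ` are measured by the POVM `A` on `ℂᵈ ⊗ ℂᵈ`; outcome `j` occurs with
probability `tr((ρ ⊗ ρ) A_j)`, the estimator is then `est j`, and the fidelity is `tr(ρ (est j))`.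
(Both traces are real.) -/
noncomputable def avgFidelity {d : ℕ} (A : POVM ι (Fin d × Fin d)) (est : ι → DensityOperator d) :
    ℝ :=
  ∑ j, ∫ ψ : PureState d,
    ((ketBra ψ.1 ⊗ₖ ketBra ψ.1) * A.elem j).trace.re * (ketBra ψ.1 * (est j).mat).trace.re
      ∂(haarPureState d)

/-- The (two-copy) estimation fidelity `F(A)`: the maximum of the average fidelity over all
choices of the estimators. -/
noncomputable def estimationFidelity {d : ℕ} (A : POVM ι (Fin d × Fin d)) : ℝ :=
  ⨆ est : ι → DensityOperator d, A.avgFidelity est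

end POVM

/-- The value `F₂ⁱⁱᵈ` in dimension `d`. -/
noncomputable def F2iid (d : ℕ) : ℝ :=
  2 * ((d : ℝ) ^ 2 + d + 1 + (d - 1) * Real.sqrt (d + 1)) / (d * (d + 1) * (d + 2))

/-! The third moment of a Haar-random pure state is the normalized projection onto the symmetric
subspace of three copies (`integral_trace_mul_trace_mul_trace`). Hence, up to the factor `d (d + 1)
(d + 2)` and the constant `d ^ 2 + d`, the average fidelity of a product measurement is the sum over
outcomes of `tr (ρ Q)`, where `Q = fidelityOperator A_j B_k` is bilinear in the two elements
(`POVM.avgFidelity_prod`).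

For unit vectors `x`, `y` the largest eigenvalue of `Q` on the two projectors is `(1 + |⟨x, y⟩|) ^
2`. Compatibility lets both POVMs be written over one rank-one POVM with weights `w_r` and overlaps
`o_rs`. By bilinearity, merging outcomes can only lose, so the sum is at most `∑ w_r w_s (1 + o_rs)
^ 2 = d ^ 2 + d + 2 ∑ w_r w_s o_rs`.

The remaining sum is bounded as in the theory of 2-designs (`RankOnePOVM.sum_overlap_add_gap_le`):
with `c = 1 / √(d + 1)`, an even quartic lies above `x` on `[0, 1]` and touches it only at `c` and
`1`. Its zeroth and second order sums are fixed by normalization, and its quartic term is controlled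
by the frame potential. The resulting bound is `1 + (d ^ 2 - 1) c`, which gives `F2iid`.

Both losses are kept as explicit nonnegative gaps. At equality all overlaps are `1` or `c`, and one
state is optimal for every pair of vectors merged into an outcome pair; this allows only parallel
vectors to be merged. Simplicity then excludes overlap `1` between distinct elements of one POVM, so
each is a SIC, and the common refinement makes them coincide. Conversely, identical SICs attain the
bound by direct evaluation. -/

/-! ### Isometry invariance of the surface measure on the sphere. -/

open MeasureTheory Metric Set in
open scoped Pointwise in
theorem measurePreserving_toSphere_of_linearIsometryEquiv {E : Type*} [NormedAddCommGroup E]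
    [NormedSpace ℝ E] [MeasurableSpace E] [BorelSpace E] (μ : Measure E) (U : E ≃ₗᵢ[ℝ] E)
    (hU : MeasurePreserving U μ μ) :
    MeasurePreserving
      (fun x : sphere (0 : E) 1 => (⟨U x, by simp⟩ : sphere (0 : E) 1)) μ.toSphere μ.toSphere := by
  have hcont : Continuous (fun x : sphere (0 : E) 1 => (⟨U x, by simp⟩ : sphere (0 : E) 1)) := by
    fun_prop
  refine ⟨hcont.measurable, ?_⟩
  ext s hs
  -- The surface measure of `s` is a multiple of the volume of the cone `(0, 1) • s`, and a linear
  -- isometry carries cones to cones.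
  rw [Measure.map_apply hcont.measurable hs, Measure.toSphere_apply' _ hs,
    Measure.toSphere_apply' _ (hcont.measurable hs)]
  congr 1
  rw [← hU.measure_preimage_emb U.toHomeomorph.measurableEmbedding (Ioo (0 : ℝ) 1 • (Subtype.val '' s))]
  congr 1
  ext x
  simp only [mem_preimage, mem_smul, mem_image, Subtype.exists, exists_and_right, exists_eq_right]
  constructor
  · rintro ⟨r, hr, y, ⟨hy, hys⟩, rfl⟩
    exact ⟨r, hr, U y, ⟨by simpa using hy, hys⟩, by simp⟩
  · rintro ⟨r, hr, y, ⟨hy, hys⟩, hxy⟩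
    refine ⟨r, hr, U.symm y, ⟨by simpa using hy, by simpa using hys⟩, ?_⟩
    apply U.injective
    simpa using hxy

/-! ### Third moments of a Haar-random vector. -/

section HaarMoments

open MeasureTheory ComplexConjugate

variable {d : ℕ}

instance : IsFiniteMeasure (haarPureState d) := by
  unfold haarPureState; infer_instance

theorem haarPureState_univ (hd : 1 ≤ d) : haarPureState d Set.univ = 1 := by
  have : Nonempty (Fin d) := ⟨⟨0, hd⟩⟩
  have h : (volume : Measure (EuclideanSpace ℂ (Fin d))).toSphere Set.univ ≠ 0 := by
    simp only [ne_eq, Measure.measure_univ_eq_zero]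
    exact Measure.toSphere_ne_zero _
  simp only [haarPureState, Measure.smul_apply, smul_eq_mul]
  exact ENNReal.inv_mul_cancel h (measure_ne_top _ _)

theorem integrable_haarPureState {F : Type*} [NormedAddCommGroup F]
    {f : PureState d → F} (hf : Continuous f) :
    Integrable f (haarPureState d) := by
  have : CompactSpace (PureState d) :=
    isCompact_iff_compactSpace.mp (isCompact_sphere _ _)
  exact hf.integrable_of_hasCompactSupport (HasCompactSupport.of_compactSpace f)

theorem integral_haarPureState_comp_unitary {F : Type*} [NormedAddCommGroup F] [NormedSpace ℝ F]
    (U : EuclideanSpace ℂ (Fin d) ≃ₗᵢ[ℂ] EuclideanSpace ℂ (Fin d))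
    (f : EuclideanSpace ℂ (Fin d) → F) :
    ∫ ψ, f (U ψ.1) ∂(haarPureState d) = ∫ ψ, f ψ.1 ∂(haarPureState d) := by
  let V : EuclideanSpace ℂ (Fin d) ≃ₗᵢ[ℝ] EuclideanSpace ℂ (Fin d) :=
    { U.toLinearEquiv.restrictScalars ℝ with norm_map' := U.norm_map }
  have hV := measurePreserving_toSphere_of_linearIsometryEquiv volume V V.measurePreserving
  have hemb : MeasurableEmbedding (fun x : PureState d => (⟨V x, by simp⟩ : PureState d)) := by
    let e : PureState d ≃ₜ PureState d :=
      { toFun := fun x => ⟨V x, by simp⟩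
        invFun := fun x => ⟨V.symm x, by simp⟩
        left_inv := fun x => by simp
        right_inv := fun x => by simp
        continuous_toFun := by fun_prop
        continuous_invFun := by fun_prop }
    exact e.measurableEmbedding
  simp only [haarPureState, integral_smul_measure]
  congr 1
  exact hV.integral_comp hemb (fun ψ => f ψ.1)

theorem exists_unitary_apply_eq {u v : EuclideanSpace ℂ (Fin d)} (hu : ‖u‖ = 1) (hv : ‖v‖ = 1) :
    ∃ U : EuclideanSpace ℂ (Fin d) ≃ₗᵢ[ℂ] EuclideanSpace ℂ (Fin d), U u = v := by
  have hd : 0 < d := by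
    rcases Nat.eq_zero_or_pos d with rfl | h
    · rw [Subsingleton.elim u 0] at hu; simp at hu
    · exact h
  have key : ∀ w : EuclideanSpace ℂ (Fin d), ‖w‖ = 1 →
      ∃ b : OrthonormalBasis (Fin d) ℂ (EuclideanSpace ℂ (Fin d)), b ⟨0, hd⟩ = w := by
    intro w hw
    have ho : Orthonormal ℂ (({⟨0, hd⟩} : Set (Fin d)).domRestrict fun _ => w) := by
      constructor
      · intro i; exact hw
      · intro i j hij; exact absurd (Subsingleton.elim i j) hij
    obtain ⟨b, hb⟩ := ho.exists_orthonormalBasis_extension_of_card_eq (by simp)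
    exact ⟨b, hb _ rfl⟩
  obtain ⟨b, hb⟩ := key u hu
  obtain ⟨c, hc⟩ := key v hv
  refine ⟨b.equiv c (Equiv.refl _), ?_⟩
  rw [← hb, OrthonormalBasis.equiv_apply_basis, ← hc]
  rfl

/-- By unitary invariance the integral depends on `u` only through its norm, and homogeneity fixes
how. The constant `m` is evaluated only later. -/
theorem exists_integral_inner_pow_eq (hd : 1 ≤ d) : ∃ m : ℂ, ∀ u : EuclideanSpace ℂ (Fin d),
    ∫ ψ : PureState d, (inner ℂ u ψ.1 * inner ℂ ψ.1 u) ^ 3 ∂(haarPureState d)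
      = m * inner ℂ u u ^ 3 := by
  let e : EuclideanSpace ℂ (Fin d) := EuclideanSpace.single ⟨0, hd⟩ 1
  have he : ‖e‖ = 1 := by simp [e]
  refine ⟨∫ ψ : PureState d, (inner ℂ e ψ.1 * inner ℂ ψ.1 e) ^ 3 ∂(haarPureState d), fun u => ?_⟩
  rcases eq_or_ne u 0 with rfl | hu
  · simp
  obtain ⟨U, hU⟩ := exists_unitary_apply_eq (u := ((‖u‖⁻¹ : ℝ) : ℂ) • u) (v := e)
    (by simp [norm_smul, hu]) he
  have hu' : U u = (‖u‖ : ℂ) • e := by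
    rw [← hU, ← map_smul, smul_smul]
    simp [hu]
  rw [← integral_haarPureState_comp_unitary U.symm
    (fun ψ => (inner ℂ u ψ * inner ℂ ψ u) ^ 3), ← integral_mul_const]
  congr 1
  ext ψ
  have h1 : inner ℂ u (U.symm ψ.1) = ‖u‖ * inner ℂ e ψ.1 := by
    rw [← U.inner_map_map, hu', inner_smul_left]; simp
  have h2 : inner ℂ (U.symm ψ.1) u = ‖u‖ * inner ℂ ψ.1 e := by
    rw [← U.inner_map_map, hu', inner_smul_right]; simp
  rw [h1, h2, inner_self_eq_norm_sq_to_K]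
  simp only [Complex.coe_algebraMap]
  ring

/-- A polynomial vanishing on the unit circle, an infinite set, is zero; only its constant
coefficient is needed. -/
theorem eq_zero_of_sum_mul_pow_eq_zero {n : ℕ} (f : Fin (n + 1) → ℂ)
    (h : ∀ z : ℂ, ‖z‖ = 1 → ∑ k, f k * z ^ (k : ℕ) = 0) : f 0 = 0 := by
  have hinf : (Metric.sphere (0 : ℂ) 1).Infinite := by
    apply IsPreconnected.infinite_of_nontrivial
    · exact isPreconnected_sphere (by simp) _ _
    · exact ⟨1, by simp, -1, by simp, by norm_num⟩
  let p : Polynomial ℂ := ∑ k, Polynomial.C (f k) * Polynomial.X ^ (k : ℕ)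
  have hp : p = 0 := by
    apply Polynomial.eq_zero_of_infinite_isRoot
    refine hinf.mono fun z hz => ?_
    simp only [Set.mem_ofPred_eq, Polynomial.IsRoot, p, Polynomial.eval_finsetSum]
    simpa using h z (by simpa using hz)
  have := congrArg (fun q => Polynomial.coeff q 0) hp
  simp only [p, Polynomial.finsetSum_coeff, Polynomial.coeff_C_mul_X_pow,
    Polynomial.coeff_zero] at this
  rw [Finset.sum_eq_single 0] at this
  · simpa using this
  · intro k _ hk
    rw [if_neg]
    intro h0
    exact hk (Fin.ext (by simpa using h0.symm))
  · simp

/-- Polarization by a phase: put `u = y + z • x` with `‖z‖ = 1` into the hypothesis and multiply by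
`z ^ 3`. Both sides become polynomials in `z`, whose constant coefficients are the two sides of the
claim. -/
theorem integral_inner_pow_mul_inner_pow {m : ℂ}
    (hm : ∀ u : EuclideanSpace ℂ (Fin d),
      ∫ ψ : PureState d, (inner ℂ u ψ.1 * inner ℂ ψ.1 u) ^ 3 ∂(haarPureState d)
        = m * inner ℂ u u ^ 3) (x y : EuclideanSpace ℂ (Fin d)) :
    ∫ ψ : PureState d, inner ℂ x ψ.1 ^ 3 * inner ℂ ψ.1 y ^ 3 ∂(haarPureState d)
      = m * inner ℂ x y ^ 3 := by
  -- The coefficients of `(p + q z + r z ^ 2) ^ 3` as a polynomial in `z`.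
  let c (p q r : ℂ) : Fin 7 → ℂ := ![p ^ 3, 3 * p ^ 2 * q, 3 * p ^ 2 * r + 3 * p * q ^ 2,
    q ^ 3 + 6 * p * q * r, 3 * q ^ 2 * r + 3 * p * r ^ 2, 3 * q * r ^ 2, r ^ 3]
  have hc : ∀ p q r z : ℂ, ∑ k, c p q r k * z ^ (k : ℕ) = (p + q * z + r * z ^ 2) ^ 3 := by
    intro p q r z
    simp only [Fin.sum_univ_succ, c]
    simp
    ring
  let P (ψ : PureState d) : Fin 7 → ℂ := c (inner ℂ x ψ.1 * inner ℂ ψ.1 y)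
    (inner ℂ x ψ.1 * inner ℂ ψ.1 x + inner ℂ y ψ.1 * inner ℂ ψ.1 y) (inner ℂ y ψ.1 * inner ℂ ψ.1 x)
  let N : Fin 7 → ℂ := c (inner ℂ x y) (inner ℂ x x + inner ℂ y y) (inner ℂ y x)
  have hP : ∀ k, Continuous fun ψ => P ψ k := by
    intro k
    fin_cases k <;> simp [P, c] <;> fun_prop
  have key := eq_zero_of_sum_mul_pow_eq_zero
    (fun k => (∫ ψ, P ψ k ∂(haarPureState d)) - m * N k) ?_
  · have h0 : ∀ ψ, P ψ 0 = inner ℂ x ψ.1 ^ 3 * inner ℂ ψ.1 y ^ 3 := by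
      intro ψ; simp [P, c]; ring
    have h1 : N 0 = inner ℂ x y ^ 3 := by simp [N, c]
    simp only [h0, h1] at key
    linear_combination key
  · intro z hz
    have hzz : conj z * z = 1 := by
      rw [mul_comm, Complex.mul_conj, Complex.normSq_eq_norm_sq, hz]; simp
    have h := hm (y + z • x)
    simp only [sub_mul, Finset.sum_sub_distrib]
    have e1 : ∑ k, (∫ ψ, P ψ k ∂(haarPureState d)) * z ^ (k : ℕ)
        = z ^ 3 * ∫ ψ : PureState d, (inner ℂ (y + z • x) ψ.1 * inner ℂ ψ.1 (y + z • x)) ^ 3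
          ∂(haarPureState d) := by
      simp only [← integral_mul_const, ← integral_const_mul]
      rw [← integral_finsetSum]
      · congr 1
        ext ψ
        rw [hc]
        simp only [inner_add_left, inner_add_right, inner_smul_left, inner_smul_right]
        rw [← mul_pow]
        congr 1
        linear_combination (-(inner ℂ x ψ.1 * inner ℂ ψ.1 y) - z * inner ℂ x ψ.1 * inner ℂ ψ.1 x)
          * hzz
      · intro k _
        exact (integrable_haarPureState (hP k)).mul_const _
    have e2 : ∑ k, m * N k * z ^ (k : ℕ)
        = z ^ 3 * (m * inner ℂ (y + z • x) (y + z • x) ^ 3) := by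
      simp only [mul_assoc, ← Finset.mul_sum]
      rw [hc, mul_left_comm, ← mul_pow]
      congr 2
      simp only [inner_add_left, inner_add_right, inner_smul_left, inner_smul_right]
      linear_combination (-(inner ℂ x y) - z * inner ℂ x x) * hzz
    rw [e1, e2, h, sub_self]

theorem integral_mul_mul_eq_polarization {f g h w : PureState d → ℂ} (hf : Continuous f)
    (hg : Continuous g) (hh : Continuous h) (hw : Continuous w) :
    6 * ∫ ψ, f ψ * g ψ * h ψ * w ψ ∂(haarPureState d)
      = (∫ ψ, (f ψ + g ψ + h ψ) ^ 3 * w ψ ∂(haarPureState d))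
        - (∫ ψ, (f ψ + g ψ) ^ 3 * w ψ ∂(haarPureState d))
        - (∫ ψ, (f ψ + h ψ) ^ 3 * w ψ ∂(haarPureState d))
        - (∫ ψ, (g ψ + h ψ) ^ 3 * w ψ ∂(haarPureState d))
        + (∫ ψ, f ψ ^ 3 * w ψ ∂(haarPureState d)) + (∫ ψ, g ψ ^ 3 * w ψ ∂(haarPureState d))
        + (∫ ψ, h ψ ^ 3 * w ψ ∂(haarPureState d)) := by
  rw [← integral_const_mul, ← integral_sub, ← integral_sub, ← integral_sub, ← integral_add,
    ← integral_add, ← integral_add]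
  · congr 1; ext ψ; ring
  all_goals exact integrable_haarPureState (by fun_prop)

/-- Cubes determine symmetric trilinear forms, so polarizing first in the bras and then in the kets
yields the sum over the six permutations. -/
theorem integral_prod_inner {m : ℂ}
    (hm : ∀ u : EuclideanSpace ℂ (Fin d),
      ∫ ψ : PureState d, (inner ℂ u ψ.1 * inner ℂ ψ.1 u) ^ 3 ∂(haarPureState d)
        = m * inner ℂ u u ^ 3) (x y z x' y' z' : EuclideanSpace ℂ (Fin d)) :
    ∫ ψ : PureState d, inner ℂ x ψ.1 * inner ℂ y ψ.1 * inner ℂ z ψ.1 *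
        (inner ℂ ψ.1 x' * inner ℂ ψ.1 y' * inner ℂ ψ.1 z') ∂(haarPureState d)
      = m / 6 * (inner ℂ x x' * inner ℂ y y' * inner ℂ z z'
          + inner ℂ x x' * inner ℂ y z' * inner ℂ z y'
          + inner ℂ x y' * inner ℂ y x' * inner ℂ z z'
          + inner ℂ x y' * inner ℂ y z' * inner ℂ z x'
          + inner ℂ x z' * inner ℂ y x' * inner ℂ z y'
          + inner ℂ x z' * inner ℂ y y' * inner ℂ z x') := by
  have h1 : ∀ v : EuclideanSpace ℂ (Fin d),
      ∫ ψ : PureState d, inner ℂ x ψ.1 * inner ℂ y ψ.1 * inner ℂ z ψ.1 * inner ℂ ψ.1 v ^ 3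
        ∂(haarPureState d) = m * (inner ℂ x v * inner ℂ y v * inner ℂ z v) := by
    intro v
    have := integral_mul_mul_eq_polarization (d := d) (f := fun ψ => inner ℂ x ψ.1)
      (g := fun ψ => inner ℂ y ψ.1) (h := fun ψ => inner ℂ z ψ.1)
      (w := fun ψ => inner ℂ ψ.1 v ^ 3) (by fun_prop) (by fun_prop) (by fun_prop) (by fun_prop)
    simp only [← inner_add_left, integral_inner_pow_mul_inner_pow hm] at this
    simp only [inner_add_left] at this
    linear_combination (1 / 6) * this
  have := integral_mul_mul_eq_polarization (d := d) (f := fun ψ => inner ℂ ψ.1 x')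
    (g := fun ψ => inner ℂ ψ.1 y') (h := fun ψ => inner ℂ ψ.1 z')
    (w := fun ψ => inner ℂ x ψ.1 * inner ℂ y ψ.1 * inner ℂ z ψ.1)
    (by fun_prop) (by fun_prop) (by fun_prop) (by fun_prop)
  simp only [← inner_add_right, mul_comm _ (inner ℂ x _ * _ * _), h1] at this
  simp only [inner_add_right] at this
  linear_combination (1 / 6) * this

end HaarMoments

/-! ### The third moment as a trilinear form on matrices. -/

section TraceMoments

open MeasureTheory Matrix

variable {d : ℕ}

/-- The operator `|y⟩⟨x|`. -/
def outerProduct (y x : EuclideanSpace ℂ (Fin d)) : Matrix (Fin d) (Fin d) ℂ :=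
  Matrix.of fun a b => y a * star (x b)

theorem ketBra_eq_outerProduct (x : EuclideanSpace ℂ (Fin d)) : ketBra x = outerProduct x x := rfl

theorem trace_outerProduct (y x : EuclideanSpace ℂ (Fin d)) :
    (outerProduct y x).trace = inner ℂ x y := by
  simp [outerProduct, Matrix.trace, PiLp.inner_apply]

theorem outerProduct_mul_outerProduct (y x y' x' : EuclideanSpace ℂ (Fin d)) :
    outerProduct y x * outerProduct y' x' = (inner ℂ x y' : ℂ) • outerProduct y x' := by
  ext a b
  simp only [outerProduct, Matrix.mul_apply, Matrix.of_apply, PiLp.inner_apply, Matrix.smul_apply,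
    smul_eq_mul, Finset.sum_mul, RCLike.inner_apply, starRingEnd_apply]
  exact Finset.sum_congr rfl fun _ _ => by ring

theorem trace_ketBra_mul_outerProduct (ψ y x : EuclideanSpace ℂ (Fin d)) :
    (ketBra ψ * outerProduct y x).trace = inner ℂ ψ y * inner ℂ x ψ := by
  rw [ketBra_eq_outerProduct, outerProduct_mul_outerProduct, trace_smul, trace_outerProduct,
    smul_eq_mul]

theorem sum_outerProduct_single (M : Matrix (Fin d) (Fin d) ℂ) :
    ∑ b, outerProduct (WithLp.toLp 2 fun a => M a b) (EuclideanSpace.single b 1) = M := by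
  ext a b
  simp [outerProduct, Matrix.sum_apply, apply_ite]

@[fun_prop]
theorem continuous_trace_ketBra_mul (M : Matrix (Fin d) (Fin d) ℂ) :
    Continuous fun ψ : PureState d => (ketBra ψ.1 * M).trace := by
  rw [← sum_outerProduct_single M]
  simp only [Finset.mul_sum, trace_sum, trace_ketBra_mul_outerProduct]
  fun_prop

/-- The trilinear form `tr (6 P (A ⊗ B ⊗ C))`, where `P` is the projection onto the symmetric
subspace of the threefold tensor power. -/
noncomputable def symTrace (A B C : Matrix (Fin d) (Fin d) ℂ) : ℂ :=
  A.trace * B.trace * C.trace + A.trace * (B * C).trace + B.trace * (A * C).trace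
    + C.trace * (A * B).trace + (A * B * C).trace + (A * C * B).trace

theorem symTrace_rotate (A B C : Matrix (Fin d) (Fin d) ℂ) : symTrace A B C = symTrace B C A := by
  simp only [symTrace]
  rw [trace_mul_comm A C, trace_mul_comm A B, trace_mul_cycle B C A, trace_mul_cycle B A C]
  rw [trace_mul_cycle A C B, trace_mul_cycle B A C]
  ring

theorem symTrace_sum {α : Type*} (s : Finset α) (A : α → Matrix (Fin d) (Fin d) ℂ)
    (B C : Matrix (Fin d) (Fin d) ℂ) :
    symTrace (∑ i ∈ s, A i) B C = ∑ i ∈ s, symTrace (A i) B C := by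
  simp only [symTrace, trace_sum, Finset.sum_mul, Finset.mul_sum, Finset.sum_add_distrib]

theorem integral_trace_rotate (A B C : Matrix (Fin d) (Fin d) ℂ) :
    ∫ ψ : PureState d, (ketBra ψ.1 * A).trace * (ketBra ψ.1 * B).trace * (ketBra ψ.1 * C).trace
      ∂(haarPureState d)
    = ∫ ψ : PureState d, (ketBra ψ.1 * B).trace * (ketBra ψ.1 * C).trace * (ketBra ψ.1 * A).trace
      ∂(haarPureState d) := by
  congr 1; ext ψ; ring

theorem integral_trace_sum {α : Type*} (s : Finset α) (A : α → Matrix (Fin d) (Fin d) ℂ)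
    (B C : Matrix (Fin d) (Fin d) ℂ) :
    ∫ ψ : PureState d, (ketBra ψ.1 * ∑ i ∈ s, A i).trace * (ketBra ψ.1 * B).trace *
      (ketBra ψ.1 * C).trace ∂(haarPureState d)
    = ∑ i ∈ s, ∫ ψ : PureState d, (ketBra ψ.1 * A i).trace * (ketBra ψ.1 * B).trace *
      (ketBra ψ.1 * C).trace ∂(haarPureState d) := by
  simp only [Finset.mul_sum, trace_sum, Finset.sum_mul]
  exact integral_finsetSum _ fun i _ => integrable_haarPureState (by fun_prop)

/-- Both sides are trilinear and invariant under rotating the arguments, so it suffices to check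
operators `|y⟩⟨x|`, one slot at a time. -/
theorem integral_trace_mul_trace_mul_trace (hd : 1 ≤ d) (A B C : Matrix (Fin d) (Fin d) ℂ) :
    ∫ ψ : PureState d, (ketBra ψ.1 * A).trace * (ketBra ψ.1 * B).trace * (ketBra ψ.1 * C).trace
      ∂(haarPureState d) = symTrace A B C / (d * (d + 1) * (d + 2)) := by
  obtain ⟨m, hm⟩ := exists_integral_inner_pow_eq hd
  have key : ∀ A B C : Matrix (Fin d) (Fin d) ℂ,
      ∫ ψ : PureState d, (ketBra ψ.1 * A).trace * (ketBra ψ.1 * B).trace *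
        (ketBra ψ.1 * C).trace ∂(haarPureState d) = m / 6 * symTrace A B C := by
    have ext1 : ∀ B C : Matrix (Fin d) (Fin d) ℂ, (∀ y x,
        ∫ ψ : PureState d, (ketBra ψ.1 * outerProduct y x).trace * (ketBra ψ.1 * B).trace *
          (ketBra ψ.1 * C).trace ∂(haarPureState d) = m / 6 * symTrace (outerProduct y x) B C) →
        ∀ A : Matrix (Fin d) (Fin d) ℂ, ∫ ψ : PureState d, (ketBra ψ.1 * A).trace *
          (ketBra ψ.1 * B).trace * (ketBra ψ.1 * C).trace ∂(haarPureState d)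
          = m / 6 * symTrace A B C := by
      intro B C h A
      rw [← sum_outerProduct_single A, integral_trace_sum, symTrace_sum, Finset.mul_sum]
      exact Finset.sum_congr rfl fun b _ => h _ _
    intro A B C
    refine ext1 _ _ (fun y x => ?_) A
    rw [integral_trace_rotate, symTrace_rotate]
    refine ext1 _ _ (fun y' x' => ?_) B
    rw [integral_trace_rotate, symTrace_rotate]
    refine ext1 _ _ (fun y'' x'' => ?_) C
    have := integral_prod_inner hm x'' x x' y'' y y'
    simp only [trace_ketBra_mul_outerProduct, symTrace, outerProduct_mul_outerProduct, trace_smul,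
      trace_outerProduct, smul_eq_mul, smul_mul_assoc]
    rw [show (fun ψ : PureState d => inner ℂ ψ.1 y'' * inner ℂ x'' ψ.1 *
      (inner ℂ ψ.1 y * inner ℂ x ψ.1) * (inner ℂ ψ.1 y' * inner ℂ x' ψ.1))
      = fun ψ : PureState d => inner ℂ x'' ψ.1 * inner ℂ x ψ.1 * inner ℂ x' ψ.1 *
        (inner ℂ ψ.1 y'' * inner ℂ ψ.1 y * inner ℂ ψ.1 y') by ext ψ; ring, this]
    ring
  -- Three identities determine `m`: the integrand is `1`, and `symTrace 1 1 1 = d (d + 1) (d + 2)`.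
  have h1 := key 1 1 1
  have hk : ∀ ψ : PureState d, (ketBra ψ.1).trace = 1 := by
    intro ψ
    rw [ketBra_eq_outerProduct, trace_outerProduct, inner_self_eq_norm_sq_to_K]
    simp
  simp only [mul_one, hk, integral_const, measureReal_def, haarPureState_univ hd, symTrace,
    trace_one, Fintype.card_fin] at h1
  simp only [ENNReal.toReal_one, one_smul] at h1
  have hd0 : (d : ℂ) ≠ 0 := by exact_mod_cast (by omega : d ≠ 0)
  have hd1 : (d : ℂ) + 1 ≠ 0 := by exact_mod_cast (by omega : d + 1 ≠ 0)
  have hd2 : (d : ℂ) + 2 ≠ 0 := by exact_mod_cast (by omega : d + 2 ≠ 0)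
  rw [key, eq_div_iff (by positivity)]
  linear_combination (-symTrace A B C) * h1

end TraceMoments

/-! ### Average fidelity of a product measurement. -/

section Fidelity

open MeasureTheory Matrix

variable {d : ℕ}

theorem posSemidef_ketBra (ψ : EuclideanSpace ℂ (Fin d)) : (ketBra ψ).PosSemidef := by
  have : ketBra ψ = vecMulVec ψ.ofLp (star ψ.ofLp) := rfl
  rw [this]
  exact posSemidef_vecMulVec_self_star _

theorem trace_mul_im_eq_zero {n : Type*} [Fintype n] {A B : Matrix n n ℂ} (hA : A.IsHermitian)
    (hB : B.IsHermitian) : (A * B).trace.im = 0 := by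
  rw [← Complex.conj_eq_iff_im, starRingEnd_apply, ← trace_conjTranspose, conjTranspose_mul, hA.eq,
    hB.eq, trace_mul_comm]

theorem ofReal_re_trace_mul {n : Type*} [Fintype n] {A B : Matrix n n ℂ} (hA : A.IsHermitian)
    (hB : B.IsHermitian) : (((A * B).trace.re : ℝ) : ℂ) = (A * B).trace :=
  Complex.ext rfl (trace_mul_im_eq_zero hA hB).symm

/-- The operator on `ℂᵈ` whose largest eigenvalue determines the contribution of the outcome
`A ⊗ B` to the two-copy estimation fidelity. -/
noncomputable def fidelityOperator (A B : Matrix (Fin d) (Fin d) ℂ) : Matrix (Fin d) (Fin d) ℂ :=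
  A.trace • B + B.trace • A + A * B + B * A

theorem integral_kronecker_trace (hd : 1 ≤ d) {A B ρ : Matrix (Fin d) (Fin d) ℂ}
    (hA : A.PosSemidef) (hB : B.PosSemidef) (hρ : ρ.PosSemidef) (htr : ρ.trace = 1) :
    ∫ ψ : PureState d, ((ketBra ψ.1 ⊗ₖ ketBra ψ.1) * (A ⊗ₖ B)).trace.re *
      (ketBra ψ.1 * ρ).trace.re ∂(haarPureState d)
      = ((A.trace * B.trace).re + (A * B).trace.re + (ρ * fidelityOperator A B).trace.re)
        / (d * (d + 1) * (d + 2)) := by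
  have h1 : ∀ ψ : PureState d, ((ketBra ψ.1 ⊗ₖ ketBra ψ.1) * (A ⊗ₖ B)).trace.re *
      (ketBra ψ.1 * ρ).trace.re
      = RCLike.re ((ketBra ψ.1 * A).trace * (ketBra ψ.1 * B).trace * (ketBra ψ.1 * ρ).trace) := by
    intro ψ
    have hk := (posSemidef_ketBra ψ.1).isHermitian
    rw [← mul_kronecker_mul, trace_kronecker, ← ofReal_re_trace_mul hk hA.isHermitian,
      ← ofReal_re_trace_mul hk hB.isHermitian, ← ofReal_re_trace_mul hk hρ.isHermitian]
    simp only [← Complex.ofReal_mul, RCLike.re_eq_complex_re, Complex.ofReal_re]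
  simp only [h1]
  rw [integral_re (integrable_haarPureState (by fun_prop)),
    integral_trace_mul_trace_mul_trace hd]
  have h2 : symTrace A B ρ
      = A.trace * B.trace + (A * B).trace + (ρ * fidelityOperator A B).trace := by
    simp only [symTrace, fidelityOperator, mul_add, trace_add, htr, mul_smul_comm, trace_smul,
      smul_eq_mul, mul_one, one_mul]
    rw [trace_mul_comm B ρ, trace_mul_comm A ρ, trace_mul_cycle A ρ B, trace_mul_cycle A B ρ,
      mul_assoc ρ, trace_mul_cycle B A ρ, mul_assoc ρ]
    ring
  have h3 : ((d : ℂ) * (d + 1) * (d + 2)) = ((d * (d + 1) * (d + 2) : ℝ) : ℂ) := by push_cast; ring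
  rw [h3, RCLike.re_eq_complex_re, Complex.div_ofReal_re, h2, Complex.add_re, Complex.add_re]

theorem POVM.avgFidelity_prod {ι κ : Type*} [Fintype ι] [Fintype κ] (hd : 1 ≤ d)
    (A : POVM ι (Fin d)) (B : POVM κ (Fin d)) (est : ι × κ → DensityOperator d) :
    (A.prod B).avgFidelity est = ((d : ℝ) ^ 2 + d +
      ∑ j, ∑ k, ((est (j, k)).mat * fidelityOperator (A.elem j) (B.elem k)).trace.re)
        / (d * (d + 1) * (d + 2)) := by
  have h1 : ∑ j, ∑ k, ((A.elem j).trace * (B.elem k).trace).re = (d : ℝ) ^ 2 := by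
    simp only [← Complex.re_sum]
    rw [← Finset.sum_mul_sum, ← trace_sum, ← trace_sum, A.sum_elem, B.sum_elem, trace_one]
    simp [← Complex.ofReal_natCast, ← Complex.ofReal_mul, sq]
  have h2 : ∑ j, ∑ k, (A.elem j * B.elem k).trace.re = d := by
    simp only [← Complex.re_sum, ← trace_sum]
    rw [← Finset.sum_mul_sum, A.sum_elem, B.sum_elem, one_mul, trace_one]
    simp
  generalize hD : (d : ℝ) * (d + 1) * (d + 2) = D
  rw [← h1, ← h2]
  simp only [← Finset.sum_add_distrib, Finset.sum_div, POVM.avgFidelity, Fintype.sum_prod_type]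
  refine Finset.sum_congr rfl fun j _ => Finset.sum_congr rfl fun k _ => ?_
  rw [← hD]
  exact integral_kronecker_trace hd (A.posSemidef j) (B.posSemidef k) (est (j, k)).posSemidef
    (est (j, k)).trace_eq_one

end Fidelity

/-! ### Optimal estimators for rank-one outcomes. -/

section RankOne

open Matrix ComplexConjugate

variable {d : ℕ}

theorem Matrix.PosSemidef.exists_eq_sum_ketBra {M : Matrix (Fin d) (Fin d) ℂ} (hM : M.PosSemidef) :
    ∃ u : Fin d → EuclideanSpace ℂ (Fin d), M = ∑ i, ketBra (u i) := by
  obtain ⟨X, hX⟩ : ∃ X : Matrix (Fin d) (Fin d) ℂ, M = Xᴴ * X := by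
    open scoped MatrixOrder Matrix.Norms.L2Operator in
    exact CStarAlgebra.nonneg_iff_eq_star_mul_self.mp hM.nonneg
  refine ⟨fun i => WithLp.toLp 2 fun a => star (X i a), ?_⟩
  ext a b
  simp [hX, Matrix.mul_apply, Matrix.sum_apply, ketBra]

theorem trace_ketBra (u : EuclideanSpace ℂ (Fin d)) : (ketBra u).trace = ((‖u‖ ^ 2 : ℝ) : ℂ) := by
  rw [ketBra_eq_outerProduct, trace_outerProduct, inner_self_eq_norm_sq_to_K]
  simp

theorem ketBra_smul (c : ℂ) (u : EuclideanSpace ℂ (Fin d)) :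
    ketBra (c • u) = ((‖c‖ ^ 2 : ℝ) : ℂ) • ketBra u := by
  ext a b
  simp only [ketBra, of_apply, PiLp.smul_apply, smul_eq_mul, star_mul', Matrix.smul_apply]
  rw [← Complex.normSq_eq_norm_sq, ← Complex.mul_conj, starRingEnd_apply]
  ring

theorem trace_ketBra_mul_ketBra (u v : EuclideanSpace ℂ (Fin d)) :
    (ketBra u * ketBra v).trace = ((‖(inner ℂ u v : ℂ)‖ ^ 2 : ℝ) : ℂ) := by
  rw [ketBra_eq_outerProduct v, trace_ketBra_mul_outerProduct, ← inner_conj_symm v u,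
    Complex.mul_conj, Complex.normSq_eq_norm_sq]

theorem eq_inner_smul_of_norm_inner_eq_one {u v : EuclideanSpace ℂ (Fin d)} (hu : ‖u‖ = 1)
    (hv : ‖v‖ = 1) (h : ‖(inner ℂ u v : ℂ)‖ = 1) : v = (inner ℂ u v : ℂ) • u := by
  have := (norm_inner_eq_norm_tfae ℂ u v).out 0 1
  have h0 : u ≠ 0 := by rintro rfl; simp at hu
  rcases this.mp (by rw [h, hu, hv, one_mul]) with h1 | h1
  · exact absurd h1 h0
  · rw [inner_self_eq_norm_sq_to_K, hu] at h1
    simpa using h1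

theorem ketBra_eq_of_norm_inner_eq_one {u v : EuclideanSpace ℂ (Fin d)} (hu : ‖u‖ = 1)
    (hv : ‖v‖ = 1) (h : ‖(inner ℂ u v : ℂ)‖ = 1) : ketBra u = ketBra v := by
  rw [eq_inner_smul_of_norm_inner_eq_one hu hv h, ketBra_smul, h]
  simp

/-- The projector onto the line spanned by a unit vector, as a state. -/
def PureState.toDensityOperator (v : PureState d) : DensityOperator d where
  mat := ketBra v.1
  posSemidef := posSemidef_ketBra v.1
  trace_eq_one := by rw [trace_ketBra]; simp

theorem fidelityOperator_comm (A B : Matrix (Fin d) (Fin d) ℂ) :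
    fidelityOperator A B = fidelityOperator B A := by
  simp only [fidelityOperator]; abel

theorem fidelityOperator_sum_sum {α β : Type*} (s : Finset α) (t : Finset β) (a : α → ℂ) (b : β → ℂ)
    (A : α → Matrix (Fin d) (Fin d) ℂ) (B : β → Matrix (Fin d) (Fin d) ℂ) :
    fidelityOperator (∑ r ∈ s, a r • A r) (∑ q ∈ t, b q • B q)
      = ∑ r ∈ s, ∑ q ∈ t, (a r * b q) • fidelityOperator (A r) (B q) := by
  simp only [fidelityOperator, trace_sum, trace_smul, smul_add, Finset.sum_add_distrib, smul_eq_mul]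
  congr 1
  · congr 1
    · congr 1
      · rw [Finset.sum_smul_sum]
        exact Finset.sum_congr rfl fun r _ => Finset.sum_congr rfl fun q _ => by
          simp only [smul_smul]; congr 1; ring
      · rw [Finset.sum_smul_sum, Finset.sum_comm]
        exact Finset.sum_congr rfl fun r _ => Finset.sum_congr rfl fun q _ => by
          simp only [smul_smul]; congr 1; ring
    · rw [Finset.sum_mul_sum]
      exact Finset.sum_congr rfl fun r _ => Finset.sum_congr rfl fun q _ => by
        rw [smul_mul_smul_comm]
  · rw [Finset.sum_mul_sum, Finset.sum_comm]
    exact Finset.sum_congr rfl fun r _ => Finset.sum_congr rfl fun q _ => by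
      rw [smul_mul_smul_comm, mul_comm]

theorem re_trace_ketBra_mul_fidelityOperator {x y : EuclideanSpace ℂ (Fin d)} (hx : ‖x‖ = 1)
    (hy : ‖y‖ = 1) (v : EuclideanSpace ℂ (Fin d)) :
    (ketBra v * fidelityOperator (ketBra x) (ketBra y)).trace.re
      = ‖(inner ℂ x v : ℂ)‖ ^ 2 + ‖(inner ℂ y v : ℂ)‖ ^ 2
        + 2 * (inner ℂ v x * inner ℂ x y * inner ℂ y v).re := by
  -- The terms from `A * B` and `B * A` have conjugate traces, hence equal real parts.
  have h : (ketBra v * (ketBra y * ketBra x)).trace.re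
      = (ketBra v * (ketBra x * ketBra y)).trace.re := by
    rw [← Complex.conj_re, starRingEnd_apply, ← trace_conjTranspose, conjTranspose_mul,
      conjTranspose_mul, (posSemidef_ketBra x).isHermitian.eq, (posSemidef_ketBra y).isHermitian.eq,
      (posSemidef_ketBra v).isHermitian.eq, trace_mul_comm]
  simp only [fidelityOperator, mul_add, trace_add, Complex.add_re, h, trace_ketBra, hx, hy]
  simp only [one_pow, Complex.ofReal_one, one_smul, trace_ketBra_mul_ketBra, Complex.ofReal_re,
    norm_inner_symm v]
  rw [ketBra_eq_outerProduct x, ketBra_eq_outerProduct y, outerProduct_mul_outerProduct,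
    mul_smul_comm, trace_smul, trace_ketBra_mul_outerProduct, smul_eq_mul,
    show inner ℂ x y * (inner ℂ v x * inner ℂ y v) = inner ℂ v x * inner ℂ x y * inner ℂ y v by
      ring]
  ring

theorem re_trace_ketBra_mul_fidelityOperator_le_norm {x y : EuclideanSpace ℂ (Fin d)}
    (hx : ‖x‖ = 1) (hy : ‖y‖ = 1) (v : EuclideanSpace ℂ (Fin d)) :
    (ketBra v * fidelityOperator (ketBra x) (ketBra y)).trace.re
      ≤ ‖(inner ℂ x v : ℂ)‖ ^ 2 + ‖(inner ℂ y v : ℂ)‖ ^ 2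
        + 2 * (‖(inner ℂ x v : ℂ)‖ * ‖(inner ℂ x y : ℂ)‖ * ‖(inner ℂ y v : ℂ)‖) := by
  rw [re_trace_ketBra_mul_fidelityOperator hx hy]
  have := Complex.re_le_norm (inner ℂ v x * inner ℂ x y * inner ℂ y v)
  rw [norm_mul, norm_mul, norm_inner_symm v x] at this
  linarith

/-- The largest eigenvalue of `|x⟩⟨x| + |y⟩⟨y|` is at most `1 + |⟨x, y⟩|`. Cauchy–Schwarz is applied
to `v` and its image `u` under this operator. -/
theorem norm_inner_sq_add_norm_inner_sq_le {x y : EuclideanSpace ℂ (Fin d)}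
    (hx : ‖x‖ = 1) (hy : ‖y‖ = 1) (v : EuclideanSpace ℂ (Fin d)) :
    ‖(inner ℂ x v : ℂ)‖ ^ 2 + ‖(inner ℂ y v : ℂ)‖ ^ 2
      ≤ (1 + ‖(inner ℂ x y : ℂ)‖) * ‖v‖ ^ 2 := by
  set p : ℂ := inner ℂ x v with hp
  set q : ℂ := inner ℂ y v with hq
  set c : ℝ := ‖(inner ℂ x y : ℂ)‖ with hc
  set S : ℝ := ‖p‖ ^ 2 + ‖q‖ ^ 2 with hS
  have hc0 : 0 ≤ c := norm_nonneg _
  have hS0 : 0 ≤ S := by positivity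
  let u := p • x + q • y
  have h1 : ‖u‖ ^ 2 ≤ (1 + c) * S := by
    have e1 : ‖u‖ ^ 2 = ‖p • x‖ ^ 2 + 2 * (inner ℂ (p • x) (q • y)).re + ‖q • y‖ ^ 2 :=
      norm_add_sq (𝕜 := ℂ) _ _
    have e2 : (inner ℂ (p • x) (q • y)).re ≤ ‖p‖ * ‖q‖ * c := by
      refine (Complex.re_le_norm _).trans ?_
      rw [inner_smul_left, inner_smul_right, norm_mul, norm_mul, RCLike.norm_conj, ← hc, mul_assoc]
    rw [norm_smul, norm_smul, hx, hy, mul_one, mul_one] at e1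
    nlinarith [mul_nonneg hc0 (sq_nonneg (‖p‖ - ‖q‖))]
  have h2 : inner ℂ u v = (S : ℂ) := by
    simp only [u, inner_add_left, inner_smul_left, ← hp, ← hq, hS]
    rw [mul_comm, Complex.mul_conj, mul_comm, Complex.mul_conj]
    simp [Complex.normSq_eq_norm_sq]
  have h3 : S ≤ ‖u‖ * ‖v‖ := by
    have := norm_inner_le_norm (𝕜 := ℂ) u v
    rwa [h2, Complex.norm_real, Real.norm_of_nonneg hS0] at this
  have h4 : S ^ 2 ≤ ((1 + c) * S) * ‖v‖ ^ 2 := by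
    calc S ^ 2 ≤ (‖u‖ * ‖v‖) ^ 2 := by gcongr
      _ = ‖u‖ ^ 2 * ‖v‖ ^ 2 := by ring
      _ ≤ _ := by gcongr
  rcases hS0.eq_or_lt with h | h
  · rw [← h]; positivity
  · refine le_of_mul_le_mul_right ?_ h
    linarith

/-- By `2ab ≤ a ^ 2 + b ^ 2` the cross term costs one factor `1 + |⟨x, y⟩|`; the preceding
eigenvalue bound supplies the other. -/
theorem re_trace_ketBra_mul_fidelityOperator_le {x y : EuclideanSpace ℂ (Fin d)}
    (hx : ‖x‖ = 1) (hy : ‖y‖ = 1) (v : EuclideanSpace ℂ (Fin d)) :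
    (ketBra v * fidelityOperator (ketBra x) (ketBra y)).trace.re
      ≤ (1 + ‖(inner ℂ x y : ℂ)‖) ^ 2 * ‖v‖ ^ 2 := by
  have h1 := re_trace_ketBra_mul_fidelityOperator_le_norm hx hy v
  have h2 := norm_inner_sq_add_norm_inner_sq_le hx hy v
  have hc0 : 0 ≤ ‖(inner ℂ x y : ℂ)‖ := norm_nonneg _
  nlinarith [mul_nonneg hc0 (sq_nonneg (‖(inner ℂ x v : ℂ)‖ - ‖(inner ℂ y v : ℂ)‖))]

theorem DensityOperator.re_trace_mul_fidelityOperator_le (ρ : DensityOperator d)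
    {x y : EuclideanSpace ℂ (Fin d)} (hx : ‖x‖ = 1) (hy : ‖y‖ = 1) :
    (ρ.mat * fidelityOperator (ketBra x) (ketBra y)).trace.re
      ≤ (1 + ‖(inner ℂ x y : ℂ)‖) ^ 2 := by
  obtain ⟨u, hu⟩ := ρ.posSemidef.exists_eq_sum_ketBra
  have h1 : ∑ i, ‖u i‖ ^ 2 = 1 := by
    have := ρ.trace_eq_one
    rw [hu, trace_sum] at this
    simp only [trace_ketBra] at this
    exact_mod_cast this
  rw [hu, Finset.sum_mul, trace_sum, Complex.re_sum]
  calc _ ≤ ∑ i, (1 + ‖(inner ℂ x y : ℂ)‖) ^ 2 * ‖u i‖ ^ 2 :=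
        Finset.sum_le_sum fun i _ => re_trace_ketBra_mul_fidelityOperator_le hx hy (u i)
    _ = _ := by rw [← Finset.mul_sum, h1, mul_one]

theorem exists_pureState_re_trace_mul_fidelityOperator {x y : EuclideanSpace ℂ (Fin d)}
    (hx : ‖x‖ = 1) (hy : ‖y‖ = 1) :
    ∃ v : PureState d, (ketBra v.1 * fidelityOperator (ketBra x) (ketBra y)).trace.re
      = (1 + ‖(inner ℂ x y : ℂ)‖) ^ 2 := by
  set g : ℂ := inner ℂ x y with hg
  set c : ℝ := ‖g‖ with hc
  have hc0 : 0 ≤ c := norm_nonneg _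
  -- The phase `z` aligns `z • y` with `x`; the optimal state is then the normalized sum of the two.
  obtain ⟨z, hz, hzg⟩ : ∃ z : ℂ, ‖z‖ = 1 ∧ z * g = c := by
    rcases eq_or_ne g 0 with h | h
    · exact ⟨1, by simp, by simp [hc, h]⟩
    · refine ⟨c / g, by simp [hc, h], by field_simp⟩
  have hzz : z * conj z = 1 := by
    rw [Complex.mul_conj, Complex.normSq_eq_norm_sq, hz]; simp
  have hgc : conj g = c * z := by
    have : conj (z * g) = c := by rw [hzg, Complex.conj_ofReal]
    rw [map_mul] at this
    linear_combination z * this - conj g * hzz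
  have hxx : (inner ℂ x x : ℂ) = 1 := by rw [inner_self_eq_norm_sq_to_K, hx]; simp
  have hyy : (inner ℂ y y : ℂ) = 1 := by rw [inner_self_eq_norm_sq_to_K, hy]; simp
  let u := x + z • y
  have hp : inner ℂ x u = ((1 + c : ℝ) : ℂ) := by
    simp only [u, inner_add_right, inner_smul_right, ← hg, hzg, hxx]; simp
  have hq : inner ℂ y u = ((1 + c : ℝ) : ℂ) * z := by
    simp only [u, inner_add_right, inner_smul_right, hyy]
    rw [← inner_conj_symm, ← hg, hgc]
    push_cast; ring
  have hu : ‖u‖ ^ 2 = 2 * (1 + c) := by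
    have h : (inner ℂ u u : ℂ) = ((2 * (1 + c) : ℝ) : ℂ) := by
      conv_lhs => rw [show u = x + z • y from rfl, inner_add_left, inner_smul_left]
      rw [show x + z • y = u from rfl, hp, hq]
      push_cast
      linear_combination (1 + (c : ℂ)) * hzz
    rw [← inner_self_eq_norm_sq (𝕜 := ℂ) u, h]
    exact Complex.ofReal_re _
  have hu0 : ‖u‖ ≠ 0 := by
    intro h; rw [h] at hu; nlinarith
  refine ⟨⟨((‖u‖⁻¹ : ℝ) : ℂ) • u, by simp [norm_smul, hu0]⟩, ?_⟩
  rw [ketBra_smul, Complex.norm_real, smul_mul_assoc, trace_smul, smul_eq_mul,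
    Complex.re_ofReal_mul, re_trace_ketBra_mul_fidelityOperator hx hy, hp, hq, ← inner_conj_symm,
    hp, ← hg, Complex.conj_ofReal]
  rw [show (((1 + c : ℝ) : ℂ) * g * (((1 + c : ℝ) : ℂ) * z)) = (((1 + c) ^ 2 * c : ℝ) : ℂ) by
    push_cast; linear_combination (1 + (c : ℂ)) ^ 2 * hzg]
  rw [norm_mul, hz, Complex.ofReal_re, Complex.norm_real, Real.norm_of_nonneg (by positivity),
    Real.norm_of_nonneg (by positivity), inv_pow, hu]
  have : (1 + c) ≠ 0 := by positivity
  field_simp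
  ring

/-- A maximum over pure states exists by compactness, and mixed states, being convex combinations of
pure ones, do no better. -/
theorem exists_pureState_isMax_trace (hd : 1 ≤ d) (M : Matrix (Fin d) (Fin d) ℂ) :
    ∃ v : PureState d, ∀ ρ : DensityOperator d,
      (ρ.mat * M).trace.re ≤ (ketBra v.1 * M).trace.re := by
  have : CompactSpace (PureState d) :=
    isCompact_iff_compactSpace.mp (isCompact_sphere _ _)
  have : Nonempty (PureState d) := ⟨⟨EuclideanSpace.single ⟨0, hd⟩ 1, by simp⟩⟩
  obtain ⟨v, -, hv⟩ := isCompact_univ.exists_isMaxOn Set.univ_nonempty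
    (Complex.continuous_re.comp (continuous_trace_ketBra_mul M)).continuousOn
  have hv' : ∀ w : PureState d, (ketBra w.1 * M).trace.re ≤ (ketBra v.1 * M).trace.re :=
    fun w => isMaxOn_iff.mp hv w (Set.mem_univ w)
  refine ⟨v, fun ρ => ?_⟩
  have hpure : ∀ u : EuclideanSpace ℂ (Fin d),
      (ketBra u * M).trace.re ≤ ‖u‖ ^ 2 * (ketBra v.1 * M).trace.re := by
    intro u
    rcases eq_or_ne u 0 with rfl | hu
    · have : ketBra (0 : EuclideanSpace ℂ (Fin d)) = 0 := by ext; simp [ketBra]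
      simp [this]
    · have h1 : ‖((‖u‖⁻¹ : ℝ) : ℂ) • u‖ = 1 := by simp [norm_smul, hu]
      have h2 : u = (‖u‖ : ℂ) • ((‖u‖⁻¹ : ℝ) : ℂ) • u := by
        rw [smul_smul]; simp [hu]
      have h3 : (ketBra (((‖u‖⁻¹ : ℝ) : ℂ) • u) * M).trace.re ≤ (ketBra v.1 * M).trace.re :=
        hv' ⟨_, mem_sphere_zero_iff_norm.mpr h1⟩
      conv_lhs => rw [h2, ketBra_smul, smul_mul_assoc, trace_smul, smul_eq_mul,
        Complex.re_ofReal_mul, Complex.norm_real, norm_norm]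
      gcongr
  obtain ⟨u, hu⟩ := ρ.posSemidef.exists_eq_sum_ketBra
  have h1 : ∑ i, ‖u i‖ ^ 2 = 1 := by
    have := ρ.trace_eq_one
    rw [hu, trace_sum] at this
    simp only [trace_ketBra] at this
    exact_mod_cast this
  rw [hu, Finset.sum_mul, trace_sum, Complex.re_sum]
  calc _ ≤ ∑ i, ‖u i‖ ^ 2 * (ketBra v.1 * M).trace.re := Finset.sum_le_sum fun i _ => hpure (u i)
    _ = _ := by rw [← Finset.sum_mul, h1, one_mul]

end RankOne

/-! ### Rank-one POVMs: overlap sums and the frame potential. -/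

section RankOnePOVM

open Matrix

/-- A POVM whose elements are positive multiples of rank-one projectors. -/
structure RankOnePOVM (R : Type*) [Fintype R] (d : ℕ) where
  weight : R → ℝ
  vec : R → EuclideanSpace ℂ (Fin d)
  weight_pos : ∀ r, 0 < weight r
  norm_vec : ∀ r, ‖vec r‖ = 1
  sum_eq_one : ∑ r, (weight r : ℂ) • ketBra (vec r) = 1

namespace RankOnePOVM

variable {R : Type*} [Fintype R] {d : ℕ} (C : RankOnePOVM R d)

/-- The POVM with elements `weight r • |vec r⟩⟨vec r|`. -/
def toPOVM : POVM R (Fin d) where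
  elem r := (C.weight r : ℂ) • ketBra (C.vec r)
  posSemidef r := (posSemidef_ketBra _).smul (by exact_mod_cast (C.weight_pos r).le)
  sum_elem := C.sum_eq_one

/-- The modulus of the inner product of two of the vectors. -/
noncomputable def overlap (r s : R) : ℝ := ‖(inner ℂ (C.vec r) (C.vec s) : ℂ)‖

theorem overlap_nonneg (r s : R) : 0 ≤ C.overlap r s := norm_nonneg _

theorem overlap_le_one (r s : R) : C.overlap r s ≤ 1 := by
  have := norm_inner_le_norm (𝕜 := ℂ) (C.vec r) (C.vec s)
  rwa [C.norm_vec, C.norm_vec, one_mul] at this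

theorem overlap_comm (r s : R) : C.overlap r s = C.overlap s r := norm_inner_symm _ _

theorem overlap_self (r : R) : C.overlap r r = 1 := by
  rw [overlap, inner_self_eq_norm_sq_to_K, C.norm_vec]; simp

theorem trace_ketBra_vec (r : R) : (ketBra (C.vec r)).trace = 1 := by
  rw [trace_ketBra, C.norm_vec]; simp

theorem sum_weight : ∑ r, C.weight r = d := by
  have h := congrArg trace C.sum_eq_one
  simp only [trace_sum, trace_smul, trace_ketBra_vec, trace_one, Fintype.card_fin, smul_eq_mul,
    mul_one] at h
  exact_mod_cast h

theorem sum_weight_mul_overlap_sq (r : R) : ∑ s, C.weight s * C.overlap r s ^ 2 = 1 := by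
  have h := congrArg (fun M => (ketBra (C.vec r) * M).trace) C.sum_eq_one
  simp only [Finset.mul_sum, trace_sum, mul_smul_comm, trace_smul, trace_ketBra_mul_ketBra, mul_one,
    trace_ketBra_vec, smul_eq_mul] at h
  simp only [overlap]
  exact_mod_cast h

theorem sum_sum_weight : ∑ r, ∑ s, C.weight r * C.weight s = (d : ℝ) ^ 2 := by
  rw [← Finset.sum_mul_sum, C.sum_weight, sq]

theorem sum_sum_weight_mul_overlap_sq :
    ∑ r, ∑ s, C.weight r * C.weight s * C.overlap r s ^ 2 = d := by
  simp only [mul_assoc, ← Finset.mul_sum, sum_weight_mul_overlap_sq, mul_one, sum_weight]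

theorem trace_mul_submatrix_swap (A B : Matrix (Fin d) (Fin d) ℂ) :
    ((A ⊗ₖ B) * (1 : Matrix (Fin d × Fin d) (Fin d × Fin d) ℂ).submatrix id Prod.swap).trace
      = (A * B).trace := by
  simp only [Matrix.trace, Matrix.diag_apply, Matrix.mul_apply, Fintype.sum_prod_type,
    Matrix.submatrix_apply, Matrix.one_apply, id, Prod.swap, Prod.mk.injEq, mul_ite, mul_one,
    mul_zero, Matrix.kroneckerMap_apply, ite_and]
  simp

/-- With `G = ∑ w_r |x_r x_r⟩⟨x_r x_r|` and the swap `W`, the Hermitian operator `X = (d + 1) G - 1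
- W` measures the deviation from a 2-design, and `tr (X * X) ≥ 0` is the claim. -/
theorem frame_potential_ge :
    2 * (d : ℝ) ≤ (d + 1) * ∑ r, ∑ s, C.weight r * C.weight s * C.overlap r s ^ 4 := by
  let W : Matrix (Fin d × Fin d) (Fin d × Fin d) ℂ := (1 : Matrix _ _ ℂ).submatrix id Prod.swap
  let G : Matrix (Fin d × Fin d) (Fin d × Fin d) ℂ :=
    ∑ r, (C.weight r : ℂ) • (ketBra (C.vec r) ⊗ₖ ketBra (C.vec r))
  set V : ℝ := ∑ r, ∑ s, C.weight r * C.weight s * C.overlap r s ^ 4 with hV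
  have hGG : (G * G).trace = (V : ℂ) := by
    simp only [G, Finset.sum_mul_sum, trace_sum, smul_mul_smul_comm, trace_smul,
      ← mul_kronecker_mul, trace_kronecker, trace_ketBra_mul_ketBra, hV, smul_eq_mul]
    push_cast
    refine Finset.sum_congr rfl fun r _ => Finset.sum_congr rfl fun s _ => ?_
    rw [overlap]; ring
  have hG : G.trace = d := by
    simp only [G, trace_sum, trace_smul, trace_kronecker, trace_ketBra_vec, smul_eq_mul, mul_one]
    exact_mod_cast C.sum_weight
  have hGW : (G * W).trace = d := by
    simp only [G, W, Finset.sum_mul, trace_sum, smul_mul_assoc, trace_smul,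
      trace_mul_submatrix_swap, trace_ketBra_mul_ketBra, smul_eq_mul]
    rw [← Complex.ofReal_natCast, ← C.sum_weight]
    push_cast
    refine Finset.sum_congr rfl fun r _ => ?_
    have := C.overlap_self r
    rw [overlap] at this
    rw [this]; simp
  have hW : W.trace = d := by
    have := trace_mul_submatrix_swap (1 : Matrix (Fin d) (Fin d) ℂ) 1
    simpa [W] using this
  have hWW : W * W = 1 := by
    ext p q
    simp [W, Matrix.mul_apply, Matrix.one_apply]
  have hWH : Wᴴ = W := by
    ext p q
    simp only [W, conjTranspose_apply, submatrix_apply, id, one_apply, apply_ite star, star_one,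
      star_zero]
    congr 1
    rw [eq_iff_iff]
    constructor <;> (intro h; rw [h]; simp)
  have hGH : Gᴴ = G := by
    simp only [G, conjTranspose_sum, conjTranspose_smul]
    refine Finset.sum_congr rfl fun r _ => ?_
    rw [((posSemidef_ketBra _).kronecker (posSemidef_ketBra _)).isHermitian.eq]
    simp
  let X := ((d : ℂ) + 1) • G - 1 - W
  have hXH : Xᴴ = X := by
    simp [X, conjTranspose_sub, conjTranspose_smul, hGH, hWH]
  have h0 : 0 ≤ (Xᴴ * X).trace.re :=
    (Complex.le_def.mp (posSemidef_conjTranspose_mul_self X).trace_nonneg).1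
  have hX : (X * X).trace = (((d : ℝ) + 1) * ((d + 1) * V - 2 * d) : ℝ) := by
    have e : X * X = ((d : ℂ) + 1) ^ 2 • (G * G) - ((d : ℂ) + 1) • (G + G)
        - ((d : ℂ) + 1) • (G * W + W * G) + (1 + 1) + (W + W) := by
      simp only [X, sub_mul, mul_sub, smul_mul_assoc, mul_smul_comm, hWW, mul_one, one_mul]
      module
    rw [e]
    simp only [trace_add, trace_sub, trace_smul, hGG, hG, trace_mul_comm W G, hGW, hW, trace_one,
      Fintype.card_prod, Fintype.card_fin, smul_eq_mul]
    push_cast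
    ring
  rw [hXH, hX, Complex.ofReal_re] at h0
  have h1 : (0 : ℝ) < d + 1 := by positivity
  have := nonneg_of_mul_nonneg_right h0 h1
  linarith

/-- The tangent polynomial bound: on `[0, 1]`, `x` is at most an even quartic in `x` that agrees
with `x` only at `x = 1` and at `x = c`. -/
theorem quartic_identity (c x : ℝ) :
    2 * c * (1 + c) ^ 2 * x = c ^ 2 * (1 + 2 * c) + (1 + 2 * c + 3 * c ^ 2) * x ^ 2 - x ^ 4
      - (1 - x) * (x - c) ^ 2 * (x + 1 + 2 * c) := by
  ring

/-- Sum `quartic_identity` against the weights. The fourth power enters with a negative sign, so the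
lower bound on the frame potential is what is needed; the remainder is kept for the equality case.
-/
theorem sum_overlap_add_gap_le {c : ℝ} (hc : c ^ 2 * ((d : ℝ) + 1) = 1) (hc0 : 0 < c) :
    (∑ r, ∑ s, C.weight r * C.weight s * C.overlap r s)
      + (∑ r, ∑ s, C.weight r * C.weight s *
          ((1 - C.overlap r s) * (C.overlap r s - c) ^ 2 * (C.overlap r s + 1 + 2 * c)))
        / (2 * c * (1 + c) ^ 2)
      ≤ 1 + ((d : ℝ) ^ 2 - 1) * c := by
  have hV := C.frame_potential_ge
  set V : ℝ := ∑ r, ∑ s, C.weight r * C.weight s * C.overlap r s ^ 4 with hVdef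
  set T : ℝ := ∑ r, ∑ s, C.weight r * C.weight s *
    ((1 - C.overlap r s) * (C.overlap r s - c) ^ 2 * (C.overlap r s + 1 + 2 * c)) with hT
  set S : ℝ := ∑ r, ∑ s, C.weight r * C.weight s * C.overlap r s with hS
  have h1 : 2 * c * (1 + c) ^ 2 * S
      = c ^ 2 * (1 + 2 * c) * (d : ℝ) ^ 2 + (1 + 2 * c + 3 * c ^ 2) * d - V - T := by
    rw [← C.sum_sum_weight, ← C.sum_sum_weight_mul_overlap_sq, hS, hT, hVdef]
    simp only [Finset.mul_sum, ← Finset.sum_add_distrib, ← Finset.sum_sub_distrib]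
    refine Finset.sum_congr rfl fun r _ => Finset.sum_congr rfl fun s _ => ?_
    linear_combination (C.weight r * C.weight s) * quartic_identity c (C.overlap r s)
  have hV' : 2 * d * c ^ 2 ≤ V := by
    have : c ^ 2 * (2 * d) ≤ c ^ 2 * ((d + 1) * V) := by gcongr
    nlinarith
  have hK : 0 < 2 * c * (1 + c) ^ 2 := by positivity
  have h2 : T / (2 * c * (1 + c) ^ 2) * (2 * c * (1 + c) ^ 2) = T := by field_simp
  refine le_of_mul_le_mul_right ?_ hK
  rw [add_mul, h2]
  have hd' : (d : ℝ) * c ^ 2 = 1 - c ^ 2 := by linarith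
  have h3 : (d : ℝ) ^ 2 * c ^ 2 = d - 1 + c ^ 2 := by
    linear_combination ((d : ℝ) - 1) * hd'
  have h4 : c ^ 2 * (1 + 2 * c) * (d : ℝ) ^ 2 + (1 + 2 * c + 3 * c ^ 2) * d - 2 * d * c ^ 2
      = (1 + ((d : ℝ) ^ 2 - 1) * c) * (2 * c * (1 + c) ^ 2) := by
    linear_combination (1 + 2 * c - 2 * (1 + c) ^ 2) * h3 - hd'
  linarith

end RankOnePOVM

end RankOnePOVM

/-! ### Refinement to rank one. -/

section Refinement

open Matrix

variable {ι κ : Type*} [Fintype ι] [Fintype κ] {d : ℕ}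

theorem POVM.IsCoarseGraining.trans {n R : Type*} [Fintype n] [DecidableEq n] [Fintype R]
    {A : POVM ι n} {B : POVM κ n} {C : POVM R n} (hAB : A.IsCoarseGraining B)
    (hBC : B.IsCoarseGraining C) : A.IsCoarseGraining C := by
  obtain ⟨K, hK0, hK1, hK⟩ := hAB
  obtain ⟨L, hL0, hL1, hL⟩ := hBC
  refine ⟨fun j r => ∑ k, K j k * L k r,
    fun j r => Finset.sum_nonneg fun k _ => mul_nonneg (hK0 j k) (hL0 k r), fun r => ?_,
    fun j => ?_⟩
  · rw [Finset.sum_comm]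
    simp only [← Finset.sum_mul, hK1, one_mul, hL1]
  · simp only [hK, hL, Finset.smul_sum, smul_smul]
    rw [Finset.sum_comm]
    refine Finset.sum_congr rfl fun r _ => ?_
    rw [← Finset.sum_smul]
    push_cast
    rfl

theorem POVM.exists_rankOnePOVM {r : ℕ} (C : POVM (Fin r) (Fin d)) :
    ∃ (R : Type) (_ : Fintype R) (D : RankOnePOVM R d), C.IsCoarseGraining D.toPOVM := by
  classical
  choose u hu using fun j => (C.posSemidef j).exists_eq_sum_ketBra
  have hterm : ∀ p : {p : Fin r × Fin d // u p.1 p.2 ≠ 0},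
      (((‖u p.1.1 p.1.2‖ ^ 2 : ℝ) : ℂ)) •
        ketBra (((‖u p.1.1 p.1.2‖⁻¹ : ℝ) : ℂ) • u p.1.1 p.1.2) = ketBra (u p.1.1 p.1.2) := by
    intro p
    have h : ‖u p.1.1 p.1.2‖ ≠ 0 := norm_ne_zero_iff.mpr p.2
    rw [ketBra_smul, smul_smul, ← Complex.ofReal_mul, Complex.norm_real, norm_inv, norm_norm,
      inv_pow, mul_inv_cancel₀ (pow_ne_zero _ h)]
    simp
  -- Zero vectors are discarded because weights must be positive and vectors normalizable; they
  -- contribute nothing to the sums.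
  have hsum : ∀ f : Fin r → ℂ, ∑ p : {p : Fin r × Fin d // u p.1 p.2 ≠ 0},
      f p.1.1 • ketBra (u p.1.1 p.1.2) = ∑ j, f j • C.elem j := by
    intro f
    rw [← Finset.sum_subtype (Finset.univ.filter fun p : Fin r × Fin d => u p.1 p.2 ≠ 0) (by simp)
      (fun p => f p.1 • ketBra (u p.1 p.2)), Finset.sum_filter_of_ne, Fintype.sum_prod_type]
    · simp only [hu, Finset.smul_sum]
    · intro p _ hp h0
      refine hp ?_
      rw [h0]
      ext; simp [ketBra]
  refine ⟨{p : Fin r × Fin d // u p.1 p.2 ≠ 0}, inferInstance,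
    { weight := fun p => ‖u p.1.1 p.1.2‖ ^ 2
      vec := fun p => ((‖u p.1.1 p.1.2‖⁻¹ : ℝ) : ℂ) • u p.1.1 p.1.2
      weight_pos := fun p => by
        have := norm_pos_iff.mpr p.2
        positivity
      norm_vec := fun p => by
        have := norm_ne_zero_iff.mpr p.2
        simp [norm_smul, this]
      sum_eq_one := by
        simp only [hterm]
        simpa [C.sum_elem] using hsum 1 },
    fun j p => if p.1.1 = j then 1 else 0, fun j p => by dsimp only; split_ifs <;> simp, fun p => by simp,
    fun j => ?_⟩
  simp only [RankOnePOVM.toPOVM, hterm]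
  have := hsum fun i => if i = j then 1 else 0
  simp only [ite_smul, one_smul, zero_smul, Finset.sum_ite_eq', Finset.mem_univ, if_true] at this
  rw [← this]
  refine Finset.sum_congr rfl fun p _ => ?_
  split_ifs <;> simp

theorem POVM.Compatible.exists_rankOnePOVM {A : POVM ι (Fin d)} {B : POVM κ (Fin d)}
    (h : A.Compatible B) : ∃ (R : Type) (_ : Fintype R) (D : RankOnePOVM R d),
      A.IsCoarseGraining D.toPOVM ∧ B.IsCoarseGraining D.toPOVM := by
  obtain ⟨r, C, hA, hB⟩ := h
  obtain ⟨R, hR, D, hD⟩ := C.exists_rankOnePOVM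
  exact ⟨R, hR, D, hA.trans hD, hB.trans hD⟩

end Refinement

/-! ### The upper bound with its deficit. -/

section UpperBound

open Matrix

variable {ι κ R : Type*} [Fintype ι] [Fintype κ] [Fintype R] {d : ℕ}

theorem F2iid_eq (hd : 1 ≤ d) {c : ℝ} (hc0 : 0 < c) (hc : c ^ 2 * ((d : ℝ) + 1) = 1) :
    F2iid d = ((d : ℝ) ^ 2 + d + ((d : ℝ) ^ 2 + d + 2 * (1 + ((d : ℝ) ^ 2 - 1) * c)))
      / (d * (d + 1) * (d + 2)) := by
  have h1 : Real.sqrt (d + 1) = (d + 1) * c := by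
    rw [Real.sqrt_eq_iff_mul_self_eq (by positivity) (by positivity)]
    linear_combination -((d : ℝ) + 1) * hc
  rw [F2iid, h1]
  congr 1
  ring

/-- An exact balance: the second sum is the loss from using one estimator for all pairs merged into
an outcome. Stochasticity removes `K` and `L` from the total. -/
theorem RankOnePOVM.sum_sum_trace_add_gap (C : RankOnePOVM R d) {A : POVM ι (Fin d)}
    {B : POVM κ (Fin d)} {K : ι → R → ℝ} {L : κ → R → ℝ} (hK1 : ∀ r, ∑ j, K j r = 1)
    (hL1 : ∀ r, ∑ k, L k r = 1) (hA : ∀ j, A.elem j = ∑ r, (K j r : ℂ) • C.toPOVM.elem r)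
    (hB : ∀ k, B.elem k = ∑ r, (L k r : ℂ) • C.toPOVM.elem r) (ρ : ι → κ → DensityOperator d) :
    (∑ j, ∑ k, ((ρ j k).mat * fidelityOperator (A.elem j) (B.elem k)).trace.re)
      + ∑ j, ∑ k, ∑ r, ∑ s, K j r * L k s * (C.weight r * C.weight s *
        ((1 + C.overlap r s) ^ 2 - ((ρ j k).mat *
          fidelityOperator (ketBra (C.vec r)) (ketBra (C.vec s))).trace.re))
      = (d : ℝ) ^ 2 + d + 2 * ∑ r, ∑ s, C.weight r * C.weight s * C.overlap r s := by
  have h1 : ∀ j k, ((ρ j k).mat * fidelityOperator (A.elem j) (B.elem k)).trace.re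
      = ∑ r, ∑ s, K j r * L k s * (C.weight r * C.weight s * ((ρ j k).mat *
          fidelityOperator (ketBra (C.vec r)) (ketBra (C.vec s))).trace.re) := by
    intro j k
    simp only [hA, hB, RankOnePOVM.toPOVM, smul_smul]
    rw [fidelityOperator_sum_sum]
    simp only [Finset.mul_sum, trace_sum, mul_smul_comm, trace_smul, smul_eq_mul, Complex.re_sum,
      ← Complex.ofReal_mul, Complex.re_ofReal_mul]
    exact Finset.sum_congr rfl fun r _ => Finset.sum_congr rfl fun s _ => by ring
  have h2 : ∀ g : R → R → ℝ, ∑ j, ∑ k, ∑ r, ∑ s, K j r * L k s * g r s = ∑ r, ∑ s, g r s := by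
    intro g
    calc _ = ∑ r, ∑ s, (∑ j, K j r) * (∑ k, L k s) * g r s := by
          simp_rw [Finset.sum_mul_sum, Finset.sum_mul]
          rw [Finset.sum_congr rfl fun j _ => Finset.sum_comm, Finset.sum_comm]
          refine Finset.sum_congr rfl fun r _ => ?_
          rw [Finset.sum_congr rfl fun j _ => Finset.sum_comm, Finset.sum_comm]
      _ = _ := by simp only [hK1, hL1, one_mul]
  simp only [h1, ← Finset.sum_add_distrib]
  calc _ = ∑ j, ∑ k, ∑ r, ∑ s,
          K j r * L k s * (C.weight r * C.weight s * (1 + C.overlap r s) ^ 2) := by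
        refine Finset.sum_congr rfl fun j _ => Finset.sum_congr rfl fun k _ =>
          Finset.sum_congr rfl fun r _ => Finset.sum_congr rfl fun s _ => ?_
        ring
    _ = _ := by
        rw [h2 fun r s => C.weight r * C.weight s * (1 + C.overlap r s) ^ 2, ← C.sum_sum_weight]
        conv_rhs => enter [1, 2]; rw [← C.sum_sum_weight_mul_overlap_sq]
        simp only [Finset.mul_sum, ← Finset.sum_add_distrib]
        exact Finset.sum_congr rfl fun r _ => Finset.sum_congr rfl fun s _ => by ring

/-- The estimator gap and the quartic gap are sums of nonnegative terms, so equality makes every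
term of each vanish. -/
theorem RankOnePOVM.sum_sum_trace_le (C : RankOnePOVM R d) {A : POVM ι (Fin d)}
    {B : POVM κ (Fin d)} {K : ι → R → ℝ} {L : κ → R → ℝ} (hK0 : ∀ j r, 0 ≤ K j r)
    (hL0 : ∀ k r, 0 ≤ L k r) (hK1 : ∀ r, ∑ j, K j r = 1)
    (hL1 : ∀ r, ∑ k, L k r = 1) (hA : ∀ j, A.elem j = ∑ r, (K j r : ℂ) • C.toPOVM.elem r)
    (hB : ∀ k, B.elem k = ∑ r, (L k r : ℂ) • C.toPOVM.elem r) (ρ : ι → κ → DensityOperator d)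
    {c : ℝ} (hc0 : 0 < c) (hc : c ^ 2 * ((d : ℝ) + 1) = 1) :
    (∑ j, ∑ k, ((ρ j k).mat * fidelityOperator (A.elem j) (B.elem k)).trace.re)
        ≤ (d : ℝ) ^ 2 + d + 2 * (1 + ((d : ℝ) ^ 2 - 1) * c) ∧
    ((∑ j, ∑ k, ((ρ j k).mat * fidelityOperator (A.elem j) (B.elem k)).trace.re)
        = (d : ℝ) ^ 2 + d + 2 * (1 + ((d : ℝ) ^ 2 - 1) * c) →
      (∀ r s, C.overlap r s = 1 ∨ C.overlap r s = c) ∧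
      ∀ j k r s, 0 < K j r → 0 < L k s →
        ((ρ j k).mat * fidelityOperator (ketBra (C.vec r)) (ketBra (C.vec s))).trace.re
          = (1 + C.overlap r s) ^ 2) := by
  have h1 := C.sum_sum_trace_add_gap hK1 hL1 hA hB ρ
  have h2 := C.sum_overlap_add_gap_le hc hc0
  have hgap : ∀ j k r s, 0 ≤ K j r * L k s * (C.weight r * C.weight s *
        ((1 + C.overlap r s) ^ 2 - ((ρ j k).mat *
          fidelityOperator (ketBra (C.vec r)) (ketBra (C.vec s))).trace.re)) := by
    intro j k r s
    have := (ρ j k).re_trace_mul_fidelityOperator_le (C.norm_vec r) (C.norm_vec s)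
    exact mul_nonneg (mul_nonneg (hK0 j r) (hL0 k s)) (mul_nonneg
      (mul_nonneg (C.weight_pos r).le (C.weight_pos s).le) (sub_nonneg.mpr this))
  have hquart : ∀ r s, 0 ≤ C.weight r * C.weight s *
      ((1 - C.overlap r s) * (C.overlap r s - c) ^ 2 * (C.overlap r s + 1 + 2 * c)) := by
    intro r s
    have := C.overlap_nonneg r s
    have := sub_nonneg.mpr (C.overlap_le_one r s)
    have := C.weight_pos r
    have := C.weight_pos s
    positivity
  have hG : 0 ≤ ∑ j, ∑ k, ∑ r, ∑ s, K j r * L k s * (C.weight r * C.weight s *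
        ((1 + C.overlap r s) ^ 2 - ((ρ j k).mat *
          fidelityOperator (ketBra (C.vec r)) (ketBra (C.vec s))).trace.re)) :=
    Finset.sum_nonneg fun j _ => Finset.sum_nonneg fun k _ => Finset.sum_nonneg fun r _ =>
      Finset.sum_nonneg fun s _ => hgap j k r s
  have hT : 0 ≤ ∑ r, ∑ s, C.weight r * C.weight s *
      ((1 - C.overlap r s) * (C.overlap r s - c) ^ 2 * (C.overlap r s + 1 + 2 * c)) :=
    Finset.sum_nonneg fun r _ => Finset.sum_nonneg fun s _ => hquart r s
  have hD : 0 < 2 * c * (1 + c) ^ 2 := by positivity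
  have hTD := div_nonneg hT hD.le
  refine ⟨by linarith, fun heq => ⟨fun r s => ?_, fun j k r s hK hL => ?_⟩⟩
  · have hT0 : (∑ r, ∑ s, C.weight r * C.weight s * ((1 - C.overlap r s) *
        (C.overlap r s - c) ^ 2 * (C.overlap r s + 1 + 2 * c))) / (2 * c * (1 + c) ^ 2) = 0 := by
      linarith
    rw [div_eq_zero_iff, or_iff_left hD.ne', Finset.sum_eq_zero_iff_of_nonneg
      fun r _ => Finset.sum_nonneg fun s _ => hquart r s] at hT0
    have h := (Finset.sum_eq_zero_iff_of_nonneg fun s _ => hquart r s).mp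
      (hT0 r (Finset.mem_univ _)) s (Finset.mem_univ _)
    have h3 := C.overlap_nonneg r s
    have h4 : C.overlap r s + 1 + 2 * c ≠ 0 := by positivity
    simp only [mul_eq_zero, (C.weight_pos r).ne', (C.weight_pos s).ne', h4, or_false, false_or,
      ne_eq, OfNat.ofNat_ne_zero, not_false_eq_true, pow_eq_zero_iff] at h
    rcases h with h | h
    · left; linarith
    · right; linarith
  · have hG0 := le_antisymm (by linarith) hG
    rw [Finset.sum_eq_zero_iff_of_nonneg fun j _ => Finset.sum_nonneg fun k _ =>
      Finset.sum_nonneg fun r _ => Finset.sum_nonneg fun s _ => hgap j k r s] at hG0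
    have hG1 := hG0 j (Finset.mem_univ _)
    rw [Finset.sum_eq_zero_iff_of_nonneg fun k _ =>
      Finset.sum_nonneg fun r _ => Finset.sum_nonneg fun s _ => hgap j k r s] at hG1
    have hG2 := hG1 k (Finset.mem_univ _)
    rw [Finset.sum_eq_zero_iff_of_nonneg fun r _ =>
      Finset.sum_nonneg fun s _ => hgap j k r s] at hG2
    have hG3 := hG2 r (Finset.mem_univ _)
    rw [Finset.sum_eq_zero_iff_of_nonneg fun s _ => hgap j k r s] at hG3
    have h := hG3 s (Finset.mem_univ _)
    simp only [mul_eq_zero, (C.weight_pos r).ne', (C.weight_pos s).ne', hK.ne', hL.ne',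
      false_or] at h
    linarith

end UpperBound

/-! ### Equality forces SICs. -/

section EqualityCase

open Matrix

variable {ι κ R : Type*} [Fintype ι] [Fintype κ] [Fintype R] {d : ℕ}

theorem RankOnePOVM.isSIC (C : RankOnePOVM R d) (hd : 1 ≤ d) (A : POVM R (Fin d))
    (hA : ∀ r, A.elem r = C.toPOVM.elem r)
    (hov : ∀ r s, r ≠ s → C.overlap r s ^ 2 * ((d : ℝ) + 1) = 1) : A.IsSIC := by
  classical
  have hd0 : (d : ℝ) ≠ 0 := by exact_mod_cast (by omega : d ≠ 0)
  -- Constant overlaps turn the normalization at `r` into `w_r + (d - w_r) / (d + 1) = 1`.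
  have hw : ∀ r, C.weight r = 1 / d := by
    intro r
    have h1 := C.sum_weight_mul_overlap_sq r
    have h2 := C.sum_weight
    rw [← Finset.add_sum_erase _ _ (Finset.mem_univ r)] at h1 h2
    have h3 : (∑ s ∈ Finset.univ.erase r, C.weight s * C.overlap r s ^ 2) * ((d : ℝ) + 1)
        = ∑ s ∈ Finset.univ.erase r, C.weight s := by
      rw [Finset.sum_mul]
      refine Finset.sum_congr rfl fun s hs => ?_
      rw [mul_assoc, hov r s (Finset.ne_of_mem_erase hs).symm, mul_one]
    rw [C.overlap_self] at h1
    rw [eq_div_iff hd0]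
    linear_combination ((d : ℝ) + 1) * h1 - h3 - h2
  refine ⟨?_, C.vec, C.norm_vec, fun r s hrs => ?_, fun r => ?_⟩
  · have h := C.sum_weight
    simp only [hw, Finset.sum_const, Finset.card_univ, nsmul_eq_mul] at h
    field_simp at h
    exact_mod_cast h
  · rw [eq_div_iff (by positivity)]
    exact hov r s hrs
  · rw [hA]
    simp only [RankOnePOVM.toPOVM, hw]
    push_cast
    rfl

/-- Optimality for `(x, x)` makes `v` parallel to `x`. With `o = |⟨x, y⟩|`, optimality for `(x, y)`
then gives `(1 + o) ^ 2 ≤ 1 + 3 o ^ 2`, so `o ≥ 1` as `o > 0`. -/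
theorem overlap_eq_one_of_isMax {x y : EuclideanSpace ℂ (Fin d)} (hx : ‖x‖ = 1) (hy : ‖y‖ = 1)
    (v : PureState d) (hpos : 0 < ‖(inner ℂ x y : ℂ)‖)
    (h1 : (ketBra v.1 * fidelityOperator (ketBra x) (ketBra x)).trace.re = 4)
    (h2 : (ketBra v.1 * fidelityOperator (ketBra x) (ketBra y)).trace.re
      = (1 + ‖(inner ℂ x y : ℂ)‖) ^ 2) : ‖(inner ℂ x y : ℂ)‖ = 1 := by
  have hv : ‖v.1‖ = 1 := mem_sphere_zero_iff_norm.mp v.2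
  have hc1 : ‖(inner ℂ x y : ℂ)‖ ≤ 1 := by
    simpa [hx, hy] using norm_inner_le_norm (𝕜 := ℂ) x y
  have hp1 : ‖(inner ℂ x v.1 : ℂ)‖ ≤ 1 := by
    simpa [hx, hv] using norm_inner_le_norm (𝕜 := ℂ) x v.1
  have hp : ‖(inner ℂ x v.1 : ℂ)‖ = 1 := by
    have h3 := re_trace_ketBra_mul_fidelityOperator_le_norm hx hx v.1
    rw [h1, inner_self_eq_norm_sq_to_K, hx] at h3
    norm_num at h3
    nlinarith [norm_nonneg (inner ℂ x v.1 : ℂ)]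
  have hq : ‖(inner ℂ y v.1 : ℂ)‖ = ‖(inner ℂ x y : ℂ)‖ := by
    rw [eq_inner_smul_of_norm_inner_eq_one hx hv hp, inner_smul_right, norm_mul, hp, one_mul,
      norm_inner_symm]
  have h3 := re_trace_ketBra_mul_fidelityOperator_le_norm hx hy v.1
  rw [h2, hp, hq] at h3
  nlinarith

theorem POVM.IsSimple.elem_ne_zero {A : POVM ι (Fin d)} (hA : A.IsSimple) (hd : 1 ≤ d) (j : ι) :
    A.elem j ≠ 0 := by
  intro h
  have : ∀ k, k = j := by
    intro k
    by_contra hk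
    -- A zero element is `0` times any other, so it would be the only one.
    exact hA j k (Ne.symm hk) 0 (by simpa using h)
  have hsum := A.sum_elem
  rw [Finset.sum_eq_single j (fun k _ hk => absurd (this k) hk) (by simp), h] at hsum
  have := congrFun (congrFun hsum ⟨0, hd⟩) ⟨0, hd⟩
  simp at this

/-- A simple coarse graining of a rank-one POVM that only merges parallel elements is itself a
rank-one POVM, with vectors taken from the original one. -/
theorem POVM.IsSimple.exists_rankOnePOVM {A : POVM ι (Fin d)} (hA : A.IsSimple) (hd : 1 ≤ d)
    (C : RankOnePOVM R d) {K : ι → R → ℝ} (hK0 : ∀ j r, 0 ≤ K j r)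
    (hAC : ∀ j, A.elem j = ∑ r, (K j r : ℂ) • C.toPOVM.elem r)
    (hpar : ∀ j r s, 0 < K j r → 0 < K j s → C.overlap r s = 1) :
    ∃ (D : RankOnePOVM ι d) (f : ι → R), (∀ j, A.elem j = D.toPOVM.elem j) ∧
      (∀ j, D.vec j = C.vec (f j)) ∧ ∀ j, 0 < K j (f j) := by
  have h1 : ∀ j, ∃ r, 0 < K j r := by
    intro j
    by_contra! h
    refine hA.elem_ne_zero hd j ?_
    rw [hAC]
    refine Finset.sum_eq_zero fun r _ => ?_
    rw [le_antisymm (h r) (hK0 j r)]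
    simp
  choose f hf using h1
  have h2 : ∀ j, A.elem j = ((∑ r, K j r * C.weight r : ℝ) : ℂ) • ketBra (C.vec (f j)) := by
    intro j
    rw [hAC, Complex.ofReal_sum, Finset.sum_smul]
    refine Finset.sum_congr rfl fun r _ => ?_
    rcases (hK0 j r).eq_or_lt with h | h
    · simp [← h]
    · rw [ketBra_eq_of_norm_inner_eq_one (C.norm_vec _) (C.norm_vec r) (hpar j (f j) r (hf j) h)]
      simp only [RankOnePOVM.toPOVM, smul_smul]
      push_cast
      rfl
  refine ⟨⟨fun j => ∑ r, K j r * C.weight r, fun j => C.vec (f j), fun j => ?_,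
    fun j => C.norm_vec _, ?_⟩, f, h2, fun j => rfl, hf⟩
  · exact Finset.sum_pos' (fun r _ => mul_nonneg (hK0 j r) (C.weight_pos r).le)
      ⟨f j, Finset.mem_univ _, mul_pos (hf j) (C.weight_pos _)⟩
  · simp only [← h2, A.sum_elem]

theorem POVM.IsSimple.isSIC {A : POVM ι (Fin d)} (hA : A.IsSimple) (hd : 1 ≤ d)
    (D : RankOnePOVM ι d) (hAD : ∀ j, A.elem j = D.toPOVM.elem j) {c : ℝ}
    (hc : c ^ 2 * ((d : ℝ) + 1) = 1) (hov : ∀ j k, D.overlap j k = 1 ∨ D.overlap j k = c) :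
    A.IsSIC := by
  refine D.isSIC hd A hAD fun j k hjk => ?_
  rcases hov j k with h | h
  · refine absurd ?_ (hA j k hjk ((D.weight j : ℂ) / D.weight k))
    have hk : (D.weight k : ℂ) ≠ 0 := by exact_mod_cast (D.weight_pos k).ne'
    rw [hAD, hAD]
    simp only [RankOnePOVM.toPOVM, smul_smul]
    rw [div_mul_cancel₀ _ hk, ketBra_eq_of_norm_inner_eq_one (D.norm_vec j) (D.norm_vec k) h]
  · rw [h, hc]

theorem POVM.IsSIC.trace_elem {A : POVM ι (Fin d)} (hA : A.IsSIC) (j : ι) :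
    (A.elem j).trace = 1 / d := by
  obtain ⟨-, ψ, hψ, -, h⟩ := hA
  rw [h, trace_smul, trace_ketBra, hψ]
  simp

theorem POVM.identicalUpToRelabeling_of_forall_exists {A : POVM ι (Fin d)} {B : POVM κ (Fin d)}
    (hA : A.IsSimple) (hcard : Fintype.card ι = Fintype.card κ)
    (h : ∀ j, ∃ k, A.elem j = B.elem k) : A.IdenticalUpToRelabeling B := by
  choose f hf using h
  have hinj : Function.Injective f := by
    intro j k hjk
    by_contra hne
    exact hA j k hne 1 (by rw [hf j, hf k, hjk, one_smul])
  exact ⟨Equiv.ofBijective f ((Fintype.bijective_iff_injective_and_card f).mpr ⟨hinj, hcard⟩), hf⟩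

end EqualityCase

/-! ### Assembly of the theorem. -/

section Main

open Matrix

/-- The estimators can be optimized outcome by outcome, so the supremum is attained, by pure states.
-/
theorem POVM.exists_estimationFidelity_eq {ι κ : Type*} [Fintype ι] [Fintype κ] {d : ℕ}
    (hd : 1 ≤ d) (A : POVM ι (Fin d)) (B : POVM κ (Fin d)) :
    ∃ v : ι → κ → PureState d, (A.prod B).estimationFidelity
        = (A.prod B).avgFidelity (fun p => (v p.1 p.2).toDensityOperator) ∧
      ∀ est, (A.prod B).avgFidelity est ≤ (A.prod B).estimationFidelity := by
  choose v hv using fun j k => exists_pureState_isMax_trace hd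
    (fidelityOperator (A.elem j) (B.elem k))
  have hG : IsGreatest (Set.range (A.prod B).avgFidelity)
      ((A.prod B).avgFidelity fun p => (v p.1 p.2).toDensityOperator) := by
    refine ⟨⟨_, rfl⟩, ?_⟩
    rintro _ ⟨est, rfl⟩
    rw [POVM.avgFidelity_prod hd, POVM.avgFidelity_prod hd]
    refine div_le_div_of_nonneg_right (add_le_add_right ?_ _) (by positivity)
    exact Finset.sum_le_sum fun j _ => Finset.sum_le_sum fun k _ => hv j k _
  have hF : (A.prod B).estimationFidelity
      = (A.prod B).avgFidelity (fun p => (v p.1 p.2).toDensityOperator) := hG.csSup_eq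
  exact ⟨v, hF, fun est => hF ▸ hG.2 ⟨est, rfl⟩⟩

theorem RankOnePOVM.overlap_eq_one_of_pos {ι κ R : Type*} [Fintype κ] [Fintype R] {d : ℕ}
    (C : RankOnePOVM R d) {K : ι → R → ℝ} {L : κ → R → ℝ} (hL1 : ∀ r, ∑ k, L k r = 1)
    (v : ι → κ → PureState d) (hpos : ∀ r s, 0 < C.overlap r s)
    (h : ∀ j k r s, 0 < K j r → 0 < L k s →
      (ketBra (v j k).1 * fidelityOperator (ketBra (C.vec r)) (ketBra (C.vec s))).trace.re
        = (1 + C.overlap r s) ^ 2) (j : ι) (r s : R) (hr : 0 < K j r) (hs : 0 < K j s) :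
    C.overlap r s = 1 := by
  -- For this `k`, the state `v j k` must be optimal for both `(r, r)` and `(s, r)`.
  obtain ⟨k, -, hk⟩ : ∃ k ∈ Finset.univ, 0 < L k r := by
    apply Finset.exists_lt_of_sum_lt
    simp [hL1]
  have h1 := h j k r r hr hk
  have h2 := h j k s r hs hk
  rw [C.overlap_self] at h1
  rw [fidelityOperator_comm, C.overlap_comm] at h2
  refine overlap_eq_one_of_isMax (C.norm_vec r) (C.norm_vec s) (v j k) (hpos r s) ?_ h2
  rw [h1]; norm_num

theorem POVM.isSIC_and_identical_of_sum_eq {ι κ R : Type*} [Fintype ι] [Fintype κ] [Fintype R]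
    {d : ℕ} (hd : 1 ≤ d) {A : POVM ι (Fin d)} {B : POVM κ (Fin d)} (hAs : A.IsSimple)
    (hBs : B.IsSimple) (C : RankOnePOVM R d) {K : ι → R → ℝ} {L : κ → R → ℝ}
    (hK0 : ∀ j r, 0 ≤ K j r) (hL0 : ∀ k r, 0 ≤ L k r) (hK1 : ∀ r, ∑ j, K j r = 1)
    (hL1 : ∀ r, ∑ k, L k r = 1) (hA : ∀ j, A.elem j = ∑ r, (K j r : ℂ) • C.toPOVM.elem r)
    (hB : ∀ k, B.elem k = ∑ r, (L k r : ℂ) • C.toPOVM.elem r) (v : ι → κ → PureState d)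
    {c : ℝ} (hc0 : 0 < c) (hc : c ^ 2 * ((d : ℝ) + 1) = 1)
    (hov : ∀ r s, C.overlap r s = 1 ∨ C.overlap r s = c)
    (h : ∀ j k r s, 0 < K j r → 0 < L k s →
      (ketBra (v j k).1 * fidelityOperator (ketBra (C.vec r)) (ketBra (C.vec s))).trace.re
        = (1 + C.overlap r s) ^ 2) :
    A.IsSIC ∧ B.IsSIC ∧ A.IdenticalUpToRelabeling B := by
  have hpos : ∀ r s, 0 < C.overlap r s := by
    intro r s
    rcases hov r s with h | h <;> rw [h]
    · exact one_pos
    · exact hc0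
  have hparA := C.overlap_eq_one_of_pos hL1 v hpos h
  have hparB := C.overlap_eq_one_of_pos hK1 (fun k j => v j k) hpos fun k j r s hr hs => by
    rw [fidelityOperator_comm, C.overlap_comm]
    exact h j k s r hs hr
  obtain ⟨D, f, hAD, hDf, hf⟩ := hAs.exists_rankOnePOVM hd C hK0 hA hparA
  obtain ⟨D', g, hBD, hDg, hg⟩ := hBs.exists_rankOnePOVM hd C hL0 hB hparB
  have hA' : A.IsSIC := hAs.isSIC hd D hAD hc fun j k => by
    simp only [RankOnePOVM.overlap, hDf]
    exact hov _ _
  have hB' : B.IsSIC := hBs.isSIC hd D' hBD hc fun j k => by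
    simp only [RankOnePOVM.overlap, hDg]
    exact hov _ _
  refine ⟨hA', hB', POVM.identicalUpToRelabeling_of_forall_exists hAs
    (hA'.1.trans hB'.1.symm) fun j => ?_⟩
  -- The vector of `A_j` also feeds into some `B_k`, which merges only parallel vectors; equal
  -- traces `1 / d` then match the weights.
  obtain ⟨k, -, hk⟩ : ∃ k ∈ Finset.univ, 0 < L k (f j) := by
    apply Finset.exists_lt_of_sum_lt
    simp [hL1]
  refine ⟨k, ?_⟩
  have h1 : ketBra (D.vec j) = ketBra (D'.vec k) := by
    rw [hDf, hDg]
    exact ketBra_eq_of_norm_inner_eq_one (C.norm_vec _) (C.norm_vec _)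
      (hparB k _ _ hk (hg k))
  have h2 := (hA'.trace_elem j).trans (hB'.trace_elem k).symm
  rw [hAD, hBD] at h2 ⊢
  simp only [RankOnePOVM.toPOVM, trace_smul, RankOnePOVM.trace_ketBra_vec, smul_eq_mul,
    mul_one] at h2 ⊢
  rw [h2, h1]

/-- Measuring two copies with the same SIC, the optimal estimators reach the value `F2iid`. -/
theorem POVM.IsSIC.exists_avgFidelity_eq {ι κ : Type*} [Fintype ι] [Fintype κ] {d : ℕ}
    (hd : 1 ≤ d) {A : POVM ι (Fin d)} {B : POVM κ (Fin d)} (hA : A.IsSIC)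
    (hAB : A.IdenticalUpToRelabeling B) : ∃ est, (A.prod B).avgFidelity est = F2iid d := by
  classical
  obtain ⟨hcard, ψ, hψ, hov, hAψ⟩ := hA
  obtain ⟨e, he⟩ := hAB
  choose v hv using fun j k => exists_pureState_re_trace_mul_fidelityOperator (hψ j) (hψ k)
  refine ⟨fun p => (v p.1 (e.symm p.2)).toDensityOperator, ?_⟩
  let c : ℝ := 1 / Real.sqrt (d + 1)
  have hc0 : 0 < c := by positivity
  have hc : c ^ 2 * ((d : ℝ) + 1) = 1 := by
    simp only [c, div_pow, one_pow]
    rw [Real.sq_sqrt (by positivity)]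
    field_simp
  have hd0 : (d : ℝ) ≠ 0 := by exact_mod_cast (by omega : d ≠ 0)
  have hjk : ∀ j k, ‖(inner ℂ (ψ j) (ψ k) : ℂ)‖ = if k = j then 1 else c := by
    intro j k
    split_ifs with h
    · rw [h, inner_self_eq_norm_sq_to_K, hψ]; simp
    · have h1 := hov j k (Ne.symm h)
      have h2 : 1 / ((d : ℝ) + 1) = c ^ 2 := by
        rw [div_eq_iff (by positivity), hc]
      rw [h2] at h1
      exact (pow_left_inj₀ (norm_nonneg _) hc0.le two_ne_zero).mp h1
  have hterm : ∀ j k, (ketBra (v j k).1 * fidelityOperator (A.elem j) (A.elem k)).trace.re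
      = 1 / (d : ℝ) ^ 2 * ((if k = j then (4 - (1 + c) ^ 2) else 0) + (1 + c) ^ 2) := by
    intro j k
    have h1 : fidelityOperator (A.elem j) (A.elem k)
        = ((1 / (d : ℝ) ^ 2 : ℝ) : ℂ) • fidelityOperator (ketBra (ψ j)) (ketBra (ψ k)) := by
      have := fidelityOperator_sum_sum (Finset.univ : Finset Unit) (Finset.univ : Finset Unit)
        (fun _ => 1 / (d : ℂ)) (fun _ => 1 / (d : ℂ)) (fun _ => ketBra (ψ j))
        (fun _ => ketBra (ψ k))
      simp only [Finset.univ_unique, Finset.sum_singleton] at this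
      rw [hAψ, hAψ, this]
      congr 1
      push_cast
      ring
    rw [h1, mul_smul_comm, trace_smul, smul_eq_mul, Complex.re_ofReal_mul, hv, hjk]
    congr 1
    split_ifs <;> ring
  have hB : ∀ k, B.elem k = A.elem (e.symm k) := fun k => by rw [he, e.apply_symm_apply]
  rw [POVM.avgFidelity_prod hd, F2iid_eq hd hc0 hc]
  congr 2
  simp only [PureState.toDensityOperator, hB]
  calc _ = ∑ j, ∑ k, (ketBra (v j k).1 * fidelityOperator (A.elem j) (A.elem k)).trace.re :=
        Finset.sum_congr rfl fun j _ => Equiv.sum_comp e.symm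
          (fun k => (ketBra (v j k).1 * fidelityOperator (A.elem j) (A.elem k)).trace.re)
    _ = _ := by
      -- The `d ^ 2` diagonal pairs carry `4` and the others `(1 + c) ^ 2`, each divided by `d ^ 2`.
      simp only [hterm, ← Finset.mul_sum, Finset.sum_add_distrib, Finset.sum_ite_eq',
        Finset.mem_univ, if_true, Finset.sum_const, Finset.card_univ, hcard, nsmul_eq_mul]
      push_cast
      field_simp
      linear_combination ((d : ℝ) - 1) * hc

theorem theorem6 {d : ℕ} (hd : 1 ≤ d) {ι κ : Type*} [Fintype ι] [Fintype κ]
    (A : POVM ι (Fin d)) (B : POVM κ (Fin d)) :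
    (A.Compatible B →
      (A.prod B).estimationFidelity ≤ F2iid d ∧
      (A.IsSimple → B.IsSimple →
        ((A.prod B).estimationFidelity = F2iid d ↔
          A.IsSIC ∧ B.IsSIC ∧ A.IdenticalUpToRelabeling B))) ∧
    (F2iid d < (A.prod B).estimationFidelity → ¬ A.Compatible B) := by
  have hc0 : 0 < 1 / Real.sqrt ((d : ℝ) + 1) := by positivity
  have hc : (1 / Real.sqrt ((d : ℝ) + 1)) ^ 2 * ((d : ℝ) + 1) = 1 := by
    rw [div_pow, one_pow, Real.sq_sqrt (by positivity)]
    field_simp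
  have hD : 0 < (d : ℝ) * (d + 1) * (d + 2) := by
    have : (0 : ℝ) < d := by exact_mod_cast hd
    positivity
  obtain ⟨v, hF, hmax⟩ := A.exists_estimationFidelity_eq hd B
  have hle : A.Compatible B → (A.prod B).estimationFidelity ≤ F2iid d := by
    intro h
    obtain ⟨R, _, C, ⟨K, hK0, hK1, hA⟩, ⟨L, hL0, hL1, hB⟩⟩ := h.exists_rankOnePOVM
    rw [hF, POVM.avgFidelity_prod hd, F2iid_eq hd hc0 hc, div_le_div_iff_of_pos_right hD,
      add_le_add_iff_left]
    exact (C.sum_sum_trace_le hK0 hL0 hK1 hL1 hA hB (fun j k => (v j k).toDensityOperator)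
      hc0 hc).1
  refine ⟨fun h => ⟨hle h, fun hAs hBs => ⟨fun heq => ?_, fun hS => ?_⟩⟩,
    fun hlt h => absurd (hle h) (not_le.mpr hlt)⟩
  · obtain ⟨R, _, C, ⟨K, hK0, hK1, hA⟩, ⟨L, hL0, hL1, hB⟩⟩ := h.exists_rankOnePOVM
    rw [hF, POVM.avgFidelity_prod hd, F2iid_eq hd hc0 hc, div_left_inj' hD.ne',
      add_right_inj] at heq
    obtain ⟨hov, ht⟩ := (C.sum_sum_trace_le hK0 hL0 hK1 hL1 hA hB
      (fun j k => (v j k).toDensityOperator) hc0 hc).2 heq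
    exact POVM.isSIC_and_identical_of_sum_eq hd hAs hBs C hK0 hL0 hK1 hL1 hA hB v hc0 hc hov ht
  · obtain ⟨est, hest⟩ := hS.1.exists_avgFidelity_eq hd hS.2.2
    exact le_antisymm (hle h) (hest ▸ hmax est)

end Main
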